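/- Consider $N$ units, $T=T_0+T_1$ time periods (pre-intervention periods $t\le T_0$, post-intervention periods $t>T_0$) and interventions $0,\dots,D-1$, where $0$ is control. Unit $n$ is assigned the (random) intervention $D(n)$; let $\mathcal D=\{D(1),\dots,D(N)\}$. Potential outcomes follow the latent factor model $Y^{(d)}_{tn}=\langle u^{(d)}_t,v_n\rangle+\varepsilon_{tn}$ with random latent factors $u^{(d)}_t,v_n\in\mathbb R^r$, and the observed outcomes are $Y_{tn}=Y^{(0)}_{tn}$ for $t\le T_0$ and $Y_{tn}=Y^{(D(n))}_{tn}$ for $t>T_0$. Let $\mathcal E$ be the collection of all latent factors $u^{(d)}_t,v_n$ together with $\mathcal D$; no assumption is made on the dependence inside $\mathcal E$. Assume that, conditioned on $\mathcal E$, the shocks $\varepsilon_{tn}$ are independent and normally distributed with mean $0$ and variance $\sigma^2$. Fix an intervention $d$, let $\mathcal I^{(d)}=\{n: D(n)=d\}$ and $N_d=|\mathcal I^{(d)}|$, and let $\boldsymbol Y_{\mathrm{pre}}\in\mathbb R^{T_0\times N_d}$ and $\boldsymbol Y_{\mathrm{post}}\in\mathbb R^{T_1\times N_d}$ be the matrices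 of observed outcomes of the units in $\mathcal I^{(d)}$ in the two periods. All expectations and probabilities below are conditional on $\mathcal E$. Let $r_{\mathrm{pre}}$ and $r_{\mathrm{post}}$ be the ranks, and $s_\ell$ and $\varsigma_\ell$ the $\ell$-th largest singular values, of $\mathbb E[\boldsymbol Y_{\mathrm{pre}}]$ and $\mathbb E[\boldsymbol Y_{\mathrm{post}}]$. Let the columns of $\boldsymbol V_{\mathrm{pre}}\in\mathbb R^{N_d\times r_{\mathrm{pre}}}$ and $\boldsymbol V_{\mathrm{post}}\in\mathbb R^{N_d\times r_{\mathrm{post}}}$ be the right singular vectors of these two mean matrices for their nonzero singular values, and let the columns of $\widehat{\boldsymbol V}_{\mathrm{pre}}\in\mathbb R^{N_d\times r_{\mathrm{pre}}}$ and $\widehat{\boldsymbol V}_{\mathrm{post}}\in\mathbb R^{N_d\times r_{\mathrm{post}}}$ be the top $r_{\mathrm{pre}}$ and top $r_{\mathrm{post}}$ right singular vectors (any choice in case of ties) of $\boldsymbol Y_{\mathrm{pre}}$ and $\boldsymbol Y_{\mathrm{post}}$. Consider the hypotheses $$H_0:\ \mathrm{span}(\boldsymbol V_{\mathrm{post}})\subseteq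 \mathrm{span}(\boldsymbol V_{\mathrm{pre}}),\qquad H_1:\ \mathrm{span}(\boldsymbol V_{\mathrm{post}})\nsubseteq \mathrm{span}(\boldsymbol V_{\mathrm{pre}}),$$ and the test statistic $\widehat\tau=\|(\boldsymbol I-\widehat{\boldsymbol V}_{\mathrm{pre}}\widehat{\boldsymbol V}_{\mathrm{pre}}')\widehat{\boldsymbol V}_{\mathrm{post}}\|_F^2$. For $\alpha\in(0,1)$ define the critical value $$\tau(\alpha)=\frac{4\sigma^2 r_{\mathrm{post}}\phi_{\mathrm{pre}}^2(\alpha/2)}{s_{r_{\mathrm{pre}}}^2}+\frac{4\sigma^2 r_{\mathrm{post}}\phi_{\mathrm{post}}^2(\alpha/2)}{\varsigma_{r_{\mathrm{post}}}^2}+\frac{4\sigma r_{\mathrm{post}}\phi_{\mathrm{pre}}(\alpha/2)}{s_{r_{\mathrm{pre}}}},$$ where $\phi_{\mathrm{pre}}(a)=\sqrt{T_0}+\sqrt{N_d}+\sqrt{\log(1/a)}$ and $\phi_{\mathrm{post}}(a)=\sqrt{T_1}+\sqrt{N_d}+\sqrt{\log(1/a)}$ (a term divided by a singular value of a mean matrix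 of rank $0$ is read as $0$). Then for every $\alpha\in(0,1)$, conditioned on (almost every realization of) $\mathcal E$: (i) (Type I error) if $H_0$ holds, then $\mathbb P(\widehat\tau>\tau(\alpha)\mid\mathcal E)\le\alpha$; (ii) (Type II error) if $$r_{\mathrm{post}}>\|\boldsymbol V_{\mathrm{pre}}\boldsymbol V_{\mathrm{pre}}'\boldsymbol V_{\mathrm{post}}\|_F^2+2\tau(\alpha)+\frac{4\sigma r_{\mathrm{post}}\phi_{\mathrm{post}}(\alpha/2)}{\varsigma_{r_{\mathrm{post}}}},$$ then $H_1$ holds and $\mathbb P(\widehat\tau\le\tau(\alpha)\mid\mathcal E)\le\alpha$. -/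

import Mathlib

open MeasureTheory ProbabilityTheory
open scoped Matrix NNReal

noncomputable section

/-! ### Linear algebra -/

/-- Squared Frobenius norm of a real matrix. -/
def frobeniusSq {m n : Type*} [Fintype m] [Fintype n] (A : Matrix m n ℝ) : ℝ :=
  ∑ i, ∑ j, A i j ^ 2

/-- The `ℓ`-th singular value of `A`, in nonincreasing order and with multiplicity, counted from
`ℓ = 1`. (Mathlib counts from `0`. A matrix of rank `0` gets the value `0` at `ℓ = 0`.) -/
def singularValue {m n : Type*} [Fintype m] [Fintype n] [DecidableEq n]
    (A : Matrix m n ℝ) (ℓ : ℕ) : ℝ :=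
  (Matrix.toEuclideanLin A).singularValues (ℓ - 1)

/-- The columns of `V` are top `k` right singular vectors of `A`: they are orthonormal, and the
`j`-th column is an eigenvector of `AᵀA` for the square of the `j`-th largest singular value. -/
def IsTopRightSingularVectors {m n : Type*} [Fintype m] [Fintype n] [DecidableEq n] {k : ℕ}
    (A : Matrix m n ℝ) (V : Matrix n (Fin k) ℝ) : Prop :=
  Vᵀ * V = 1 ∧
    Aᵀ * A * V = V * Matrix.diagonal (fun j : Fin k => singularValue A (j.1 + 1) ^ 2)

/-- The subspace spanned by the columns of `V`. -/
def columnSpan {n k : Type*} (V : Matrix n k ℝ) : Submodule ℝ (n → ℝ) :=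
  Submodule.span ℝ (Set.range V.col)

/-- The function `φ(a) = √T + √n + √(log (1 / a))`. -/
def phi (T n : ℕ) (a : ℝ) : ℝ := √(T : ℝ) + √(n : ℝ) + √(Real.log (1 / a))

/-! ### The panel data model -/

/-- The random variables of a panel of `N` units over `T₀` pre-intervention and `T₁`
post-intervention periods, with `D` interventions (`0` is control) and `r` latent dimensions. -/
structure PanelModel (Ω : Type*) (T₀ T₁ N D r : ℕ) where
  /-- latent factor of a time period under an intervention -/
  u : Fin D → Fin (T₀ + T₁) → Ω → Fin r → ℝ
  /-- latent factor of a unit -/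
  v : Fin N → Ω → Fin r → ℝ
  /-- intervention assigned to a unit in the post-intervention period -/
  assign : Fin N → Ω → Fin D
  /-- idiosyncratic shock -/
  shock : Fin (T₀ + T₁) → Fin N → Ω → ℝ
  /-- potential outcome under an intervention -/
  potential : Fin D → Fin (T₀ + T₁) → Fin N → Ω → ℝ
  /-- observed outcome -/
  observed : Fin (T₀ + T₁) → Fin N → Ω → ℝ

namespace PanelModel

variable {Ω : Type*} {T₀ T₁ N D r : ℕ}

/-- The observed outcome is the one under control before the intervention, and the one under the
assigned intervention after it. -/
def SUTVA [NeZero D] (M : PanelModel Ω T₀ T₁ N D r) : Prop :=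
  (∀ (t : Fin T₀) (n : Fin N) (ω : Ω),
    M.observed (Fin.castAdd T₁ t) n ω = M.potential 0 (Fin.castAdd T₁ t) n ω) ∧
  (∀ (t : Fin T₁) (n : Fin N) (ω : Ω),
    M.observed (Fin.natAdd T₀ t) n ω = M.potential (M.assign n ω) (Fin.natAdd T₀ t) n ω)

/-- Latent factor model for the potential outcomes. -/
def LatentFactorModel (M : PanelModel Ω T₀ T₁ N D r) : Prop :=
  ∀ (d : Fin D) (t : Fin (T₀ + T₁)) (n : Fin N) (ω : Ω),
    M.potential d t n ω = M.u d t ω ⬝ᵥ M.v n ω + M.shock t n ω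

/-- The primitive objects of the model are random variables. -/
structure IsMeasurable [MeasurableSpace Ω] (M : PanelModel Ω T₀ T₁ N D r) : Prop where
  u : ∀ d t, Measurable (M.u d t)
  v : ∀ n, Measurable (M.v n)
  assign : ∀ n, Measurable (M.assign n)
  shock : ∀ t n, Measurable (M.shock t n)

/-- The collection `ℰ` of all latent factors and all intervention assignments. -/
def conditioning (M : PanelModel Ω T₀ T₁ N D r) (ω : Ω) :
    (Fin D → Fin (T₀ + T₁) → Fin r → ℝ) × (Fin N → Fin r → ℝ) × (Fin N → Fin D) :=
  (fun d t => M.u d t ω, fun n => M.v n ω, fun n => M.assign n ω)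

/-- The regular conditional probability `P(· | ℰ)` at `ω`. -/
def condProb [MeasurableSpace Ω] [StandardBorelSpace Ω] (M : PanelModel Ω T₀ T₁ N D r)
    (μ : Measure Ω) [IsProbabilityMeasure μ] (ω : Ω) : Measure Ω :=
  condExpKernel μ (MeasurableSpace.comap M.conditioning inferInstance) ω

/-- Conditioned on `ℰ`, the shocks are independent and normally distributed with mean `0` and
variance `σ ^ 2`. -/
def GaussianShocks [MeasurableSpace Ω] [StandardBorelSpace Ω] (M : PanelModel Ω T₀ T₁ N D r)
    (μ : Measure Ω) [IsProbabilityMeasure μ] (σ : ℝ≥0) : Prop :=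
  ∀ᵐ ω ∂μ,
    iIndepFun (fun p : Fin (T₀ + T₁) × Fin N => M.shock p.1 p.2) (M.condProb μ ω) ∧
    ∀ t n, (M.condProb μ ω).map (M.shock t n) = gaussianReal 0 (σ ^ 2)

/-- The group of units that receive intervention `d`. -/
abbrev Donors (M : PanelModel Ω T₀ T₁ N D r) (d : Fin D) (ω : Ω) : Type :=
  {n : Fin N // M.assign n ω = d}

/-- The number of units that receive intervention `d`. -/
def numDonors (M : PanelModel Ω T₀ T₁ N D r) (d : Fin D) (ω : Ω) : ℕ :=
  Fintype.card (M.Donors d ω)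

/-- Observed pre-intervention outcomes of the group of `d`. -/
def obsPre (M : PanelModel Ω T₀ T₁ N D r) (d : Fin D) (ω : Ω) :
    Matrix (Fin T₀) (M.Donors d ω) ℝ :=
  Matrix.of fun t j => M.observed (Fin.castAdd T₁ t) j.1 ω

/-- Observed post-intervention outcomes of the group of `d`. -/
def obsPost (M : PanelModel Ω T₀ T₁ N D r) (d : Fin D) (ω : Ω) :
    Matrix (Fin T₁) (M.Donors d ω) ℝ :=
  Matrix.of fun t j => M.observed (Fin.natAdd T₀ t) j.1 ω

section Conditional

variable [MeasurableSpace Ω] [StandardBorelSpace Ω] (M : PanelModel Ω T₀ T₁ N D r)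
  (μ : Measure Ω) [IsProbabilityMeasure μ] (d : Fin D)

/-- The conditional expectation of the pre-intervention outcomes given `ℰ`. -/
def meanPre (ω : Ω) : Matrix (Fin T₀) (M.Donors d ω) ℝ :=
  Matrix.of fun t j => ∫ ω', M.observed (Fin.castAdd T₁ t) j.1 ω' ∂(M.condProb μ ω)

/-- The conditional expectation of the post-intervention outcomes given `ℰ`. -/
def meanPost (ω : Ω) : Matrix (Fin T₁) (M.Donors d ω) ℝ :=
  Matrix.of fun t j => ∫ ω', M.observed (Fin.natAdd T₀ t) j.1 ω' ∂(M.condProb μ ω)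

/-- The rank of the conditional expectation of the pre-intervention outcomes. -/
def rankPre (ω : Ω) : ℕ := (M.meanPre μ d ω).rank

/-- The rank of the conditional expectation of the post-intervention outcomes. -/
def rankPost (ω : Ω) : ℕ := (M.meanPost μ d ω).rank

/-- The last nonzero singular value of the pre-intervention mean matrix. -/
def lastSvPre (ω : Ω) : ℝ := singularValue (M.meanPre μ d ω) (M.rankPre μ d ω)

/-- The last nonzero singular value of the post-intervention mean matrix. -/
def lastSvPost (ω : Ω) : ℝ := singularValue (M.meanPost μ d ω) (M.rankPost μ d ω)

/-- The critical value `τ(α)` with constant `C`. (A term with a matrix of rank `0`, which has no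
last nonzero singular value, is `0`.) -/
def criticalValue (C : ℝ) (σ : ℝ≥0) (α : ℝ) (ω : Ω) : ℝ :=
  C * σ ^ 2 * M.rankPost μ d ω * phi T₀ (M.numDonors d ω) (α / 2) ^ 2 / M.lastSvPre μ d ω ^ 2
  + C * σ ^ 2 * M.rankPost μ d ω * phi T₁ (M.numDonors d ω) (α / 2) ^ 2 / M.lastSvPost μ d ω ^ 2
  + C * σ * M.rankPost μ d ω * phi T₀ (M.numDonors d ω) (α / 2) / M.lastSvPre μ d ω

end Conditional

end PanelModel

/-- The test statistic `‖(I - V̂_pre V̂_preᵀ) V̂_post‖_F ^ 2`. -/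
def testStatistic {n k l : Type*} [Fintype n] [DecidableEq n] [Fintype k] [Fintype l]
    (Wpre : Matrix n k ℝ) (Wpost : Matrix n l ℝ) : ℝ :=
  frobeniusSq ((1 - Wpre * Wpreᵀ) * Wpost)

end

-- Given `ℰ`, the means and the assignment are frozen and the two group matrices are mean plus noise
-- `E`, with `E` a matrix of independent `N(0, σ²)` entries. It suffices that, outside an event of
-- probability `α/2` for each matrix, the sine of the largest principal angle between true and
-- estimated right singular subspaces is at most `a = 2σφ_pre/s` (pre) and `b = 2σφ_post/ς` (post).
-- The rest is deterministic.
--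
-- Perturbation. Bounding such an angle by `2‖E‖/s` is not enough: the usual tail `exp(-t²/2)` of
-- `‖E‖` would put `√(2 log(1/a))` into `φ`. The angle is instead controlled by `‖E f‖ + ‖E g‖` for
-- unit vectors `f` in the true subspace and `g` orthogonal to it (`SplitNormBound`). For a
-- principal vector `f`, a suitable `g` turns this sum into a bound on the sine, using only that the
-- estimated subspace carries the top singular values (`sin_sq_le_of_eigenvector`,
-- `cosineBound_of_splitNormBound`).
--
-- Probability. For a standard Gaussian matrix `G`, orthogonality of the two directions makes `⟨u₁,
-- G f⟩ + ⟨u₂, G g⟩` a Gaussian process of variance 2, whereas `2⟨u, G f⟩` has variance 4. A Slepian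
-- type comparison for exponential moments (`integral_exp_sup_le`) replaces its supremum by a sum of
-- four norms of Gaussian vectors, whose moment generating functions follow from integration by
-- parts (`integral_exp_norm_le`). The result is the tail `exp(-t²)` beyond `2(√T + √n + t)`,
-- exactly what `φ` asks for.
--
-- Test statistic. With `q` the post-period rank, `τ̂ = q - ‖Ŵ_preᵀ Ŵ_post‖_F²`, estimated by
-- columns. Nested spans give `τ̂ ≤ q(b² + 2a)`; in general `τ̂ ≥ q - ‖V_pre V_preᵀ V_post‖_F² - 2qa
-- - 2qb`. Since `τ(α) = q(a² + b² + 2a)`, both error bounds follow.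

noncomputable section

/-! ### The standard Gaussian measure on `ι → ℝ` -/

/-- The law of a family of independent standard normal variables. -/
def stdNormal (ι : Type*) [Fintype ι] : Measure (ι → ℝ) :=
  Measure.pi fun _ => gaussianReal 0 1

instance stdNormal_isProbabilityMeasure (ι : Type*) [Fintype ι] :
    IsProbabilityMeasure (stdNormal ι) := by
  unfold stdNormal; infer_instance

/-- The density of `stdNormal`. -/
def stdNormalPDF {ι : Type*} [Fintype ι] (x : ι → ℝ) : ℝ := ∏ i, gaussianPDFReal 0 1 (x i)

section StdNormal

variable {ι : Type*} [Fintype ι]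

lemma stdNormalPDF_nonneg (x : ι → ℝ) : 0 ≤ stdNormalPDF x :=
  Finset.prod_nonneg fun _ _ => gaussianPDFReal_nonneg _ _ _

lemma measurable_stdNormalPDF : Measurable (stdNormalPDF (ι := ι)) :=
  Finset.measurable_prod _ fun i _ => (measurable_gaussianPDFReal 0 1).comp (measurable_pi_apply i)

/-- Passing to Lebesgue measure with a density makes the integration by parts for line derivatives
available; it is enough to compare the two measures on boxes. -/
lemma stdNormal_eq_withDensity :
    stdNormal ι = volume.withDensity fun x : ι → ℝ => ENNReal.ofReal (stdNormalPDF x) := by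
  refine Measure.pi_eq fun s hs => ?_
  have hbox : MeasurableSet (Set.univ.pi s) := MeasurableSet.univ_pi hs
  rw [withDensity_apply _ hbox]
  have hint : Integrable (stdNormalPDF (ι := ι)) (volume.restrict (Set.univ.pi s)) := by
    refine Integrable.restrict ?_
    exact Integrable.fintype_prod fun i => integrable_gaussianPDFReal 0 1
  rw [← ofReal_integral_eq_lintegral_ofReal hint
    (Filter.Eventually.of_forall stdNormalPDF_nonneg), volume_pi, Measure.restrict_pi_pi]
  have h := integral_fintype_prod_eq_prod (𝕜 := ℝ) (μ := fun i => (volume : Measure ℝ).restrict (s i))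
    (fun (_ : ι) (x : ℝ) => gaussianPDFReal 0 1 x)
  unfold stdNormalPDF
  rw [h, ENNReal.ofReal_prod_of_nonneg
    fun i _ => integral_nonneg fun x => gaussianPDFReal_nonneg _ _ _]
  exact Finset.prod_congr rfl fun i _ => (gaussianReal_apply_eq_integral 0 one_ne_zero _).symm

lemma integral_stdNormal (f : (ι → ℝ) → ℝ) :
    ∫ x, f x ∂stdNormal ι = ∫ x, stdNormalPDF x * f x := by
  rw [stdNormal_eq_withDensity, integral_withDensity_eq_integral_toReal_smul
    measurable_stdNormalPDF.ennreal_ofReal (by simp)]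
  simp [ENNReal.toReal_ofReal (stdNormalPDF_nonneg _)]

lemma integrable_stdNormal_iff (f : (ι → ℝ) → ℝ) :
    Integrable f (stdNormal ι) ↔ Integrable fun x => stdNormalPDF x * f x := by
  rw [stdNormal_eq_withDensity, integrable_withDensity_iff_integrable_smul'
    measurable_stdNormalPDF.ennreal_ofReal (by simp)]
  simp [ENNReal.toReal_ofReal (stdNormalPDF_nonneg _)]

lemma stdNormalPDF_eq (x : ι → ℝ) :
    stdNormalPDF x = (√(2 * Real.pi))⁻¹ ^ Fintype.card ι * Real.exp (-(x ⬝ᵥ x) / 2) := by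
  simp only [stdNormalPDF, gaussianPDFReal, NNReal.coe_one, mul_one, sub_zero,
    Finset.prod_mul_distrib, Finset.prod_const, Finset.card_univ, ← Real.exp_sum]
  congr 2
  simp only [dotProduct, Finset.sum_div, neg_div, ← Finset.sum_neg_distrib, ← sq]

lemma hasLineDerivAt_stdNormalPDF (x w : ι → ℝ) :
    HasLineDerivAt ℝ stdNormalPDF (-(w ⬝ᵥ x) * stdNormalPDF x) x w := by
  unfold HasLineDerivAt
  have h : HasDerivAt (fun t : ℝ => (x + t • w) ⬝ᵥ (x + t • w)) (2 * (w ⬝ᵥ x)) 0 := by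
    have : (fun t : ℝ => (x + t • w) ⬝ᵥ (x + t • w)) =
        fun t => x ⬝ᵥ x + t * (2 * (w ⬝ᵥ x)) + t ^ 2 * (w ⬝ᵥ w) := by
      funext t
      simp only [add_dotProduct, dotProduct_add, smul_dotProduct, dotProduct_smul, smul_eq_mul,
        dotProduct_comm x w]
      ring
    rw [this]
    have := (((hasDerivAt_id (0 : ℝ)).mul_const (2 * (w ⬝ᵥ x))).const_add (x ⬝ᵥ x)).add
      (((hasDerivAt_id (0 : ℝ)).pow 2).mul_const (w ⬝ᵥ w))
    refine HasDerivAt.congr_deriv this ?_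
    simp
  have h2 := (((h.neg.div_const 2).exp).const_mul ((√(2 * Real.pi))⁻¹ ^ Fintype.card ι))
  have : (fun t : ℝ => stdNormalPDF (x + t • w)) = fun t =>
      (√(2 * Real.pi))⁻¹ ^ Fintype.card ι * Real.exp (-((x + t • w) ⬝ᵥ (x + t • w)) / 2) := by
    funext t; exact stdNormalPDF_eq _
  rw [this, stdNormalPDF_eq x]
  refine HasDerivAt.congr_deriv h2 ?_
  simp
  ring

/-- Gaussian integration by parts in the direction `w`. -/
lemma stdNormal_integral_by_parts (w : ι → ℝ) {H H' : (ι → ℝ) → ℝ}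
    (hH : ∀ x, HasLineDerivAt ℝ H (H' x) x w)
    (h₀ : Integrable H (stdNormal ι)) (h₁ : Integrable H' (stdNormal ι))
    (h₂ : Integrable (fun x => (w ⬝ᵥ x) * H x) (stdNormal ι)) :
    ∫ x, (w ⬝ᵥ x) * H x ∂stdNormal ι = ∫ x, H' x ∂stdNormal ι := by
  rw [integrable_stdNormal_iff] at h₀ h₁ h₂
  have h := integral_bilinear_hasLineDerivAt_right_eq_neg_left_of_integrable
    (μ := (volume : Measure (ι → ℝ))) (f := stdNormalPDF) (g := H) (g' := H') (v := w)
    (f' := fun x => -(w ⬝ᵥ x) * stdNormalPDF x)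
    (B := ContinuousLinearMap.mul ℝ ℝ) (by
      refine h₂.neg.congr (Filter.Eventually.of_forall fun x => ?_)
      simp; ring) (by simpa using h₁) (by simpa using h₀)
      (fun x _ => hasLineDerivAt_stdNormalPDF x w) (fun x _ => hH x)
  rw [integral_stdNormal, integral_stdNormal]
  simp only [ContinuousLinearMap.mul_apply'] at h
  rw [h, ← integral_neg]
  exact integral_congr_ae (Filter.Eventually.of_forall fun x => by simp; ring)

/-- A continuous function of at most exponential growth. -/
def ExpGrowth (f : (ι → ℝ) → ℝ) : Prop :=
  Continuous f ∧ ∃ C c : ℝ, 0 ≤ C ∧ 0 ≤ c ∧ ∀ x, |f x| ≤ C * Real.exp (c * ∑ i, |x i|)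

/-- The integrand factors over coordinates, and in one variable `exp (c|x|) ≤ exp (cx) + exp (-cx)`,
two Gaussian exponential moments. -/
lemma integrable_exp_sum_abs (c : ℝ) :
    Integrable (fun x : ι → ℝ => Real.exp (c * ∑ i, |x i|)) (stdNormal ι) := by
  have h : Integrable (fun x : ℝ => Real.exp (c * |x|)) (gaussianReal 0 1) := by
    refine ((integrable_exp_mul_gaussianReal c).add (integrable_exp_mul_gaussianReal (-c))).mono'
      (by fun_prop) (Filter.Eventually.of_forall fun x => ?_)
    rw [Real.norm_eq_abs, Real.abs_exp]
    simp only [Pi.add_apply]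
    rcases abs_cases x with ⟨h, _⟩ | ⟨h, _⟩ <;> rw [h]
    · linarith [Real.exp_pos (-c * x)]
    · rw [mul_neg, ← neg_mul]; linarith [Real.exp_pos (c * x)]
  have := Integrable.fintype_prod (𝕜 := ℝ) (μ := fun _ : ι => gaussianReal 0 1)
    (f := fun _ x => Real.exp (c * |x|)) fun i => h
  simpa only [stdNormal, Finset.mul_sum, Real.exp_sum] using this

namespace ExpGrowth

/-- The class is closed under sums and products, so this one fact discharges the integrability
conditions of the integrations by parts and the differentiation under the integral below. -/
lemma integrable {f : (ι → ℝ) → ℝ} (hf : ExpGrowth f) : Integrable f (stdNormal ι) := by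
  obtain ⟨hc, C, c, _, _, h⟩ := hf
  exact ((integrable_exp_sum_abs c).const_mul C).mono' hc.aestronglyMeasurable
    (Filter.Eventually.of_forall h)

lemma of_abs_le {f g : (ι → ℝ) → ℝ} (hg : ExpGrowth g) (hf : Continuous f)
    (h : ∀ x, |f x| ≤ |g x|) : ExpGrowth f := by
  obtain ⟨_, C, c, hC, hc, hb⟩ := hg
  exact ⟨hf, C, c, hC, hc, fun x => (h x).trans (hb x)⟩

lemma const (a : ℝ) : ExpGrowth fun _ : ι → ℝ => a :=
  ⟨continuous_const, |a|, 0, abs_nonneg a, le_rfl, fun x => by simp⟩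

lemma mul {f g : (ι → ℝ) → ℝ} (hf : ExpGrowth f) (hg : ExpGrowth g) :
    ExpGrowth fun x => f x * g x := by
  obtain ⟨hf0, C, c, hC, hc, hb⟩ := hf
  obtain ⟨hg0, C', c', hC', hc', hb'⟩ := hg
  refine ⟨hf0.mul hg0, C * C', c + c', by positivity, by positivity, fun x => ?_⟩
  rw [abs_mul, add_mul, Real.exp_add]
  calc |f x| * |g x| ≤ (C * Real.exp (c * ∑ i, |x i|)) * (C' * Real.exp (c' * ∑ i, |x i|)) :=
        mul_le_mul (hb x) (hb' x) (abs_nonneg _) (by positivity)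
    _ = _ := by ring

lemma add {f g : (ι → ℝ) → ℝ} (hf : ExpGrowth f) (hg : ExpGrowth g) :
    ExpGrowth fun x => f x + g x := by
  obtain ⟨hf0, C, c, hC, hc, hb⟩ := hf
  obtain ⟨hg0, C', c', hC', hc', hb'⟩ := hg
  refine ⟨hf0.add hg0, C + C', c + c', by positivity, by positivity, fun x => ?_⟩
  have hs : 0 ≤ ∑ i, |x i| := Finset.sum_nonneg fun i _ => abs_nonneg _
  calc |f x + g x| ≤ |f x| + |g x| := abs_add_le _ _
    _ ≤ C * Real.exp (c * ∑ i, |x i|) + C' * Real.exp (c' * ∑ i, |x i|) :=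
        add_le_add (hb x) (hb' x)
    _ ≤ C * Real.exp ((c + c') * ∑ i, |x i|) + C' * Real.exp ((c + c') * ∑ i, |x i|) := by
        gcongr <;> linarith
    _ = _ := by ring

lemma const_mul {f : (ι → ℝ) → ℝ} (a : ℝ) (hf : ExpGrowth f) : ExpGrowth fun x => a * f x :=
  (const a).mul hf

lemma sum {κ : Type*} (s : Finset κ) {f : κ → (ι → ℝ) → ℝ} (hf : ∀ a ∈ s, ExpGrowth (f a)) :
    ExpGrowth fun x => ∑ a ∈ s, f a x := by
  classical
  induction s using Finset.induction_on with
  | empty => simpa using const 0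
  | insert a s ha ih =>
    simp only [Finset.sum_insert ha]
    exact (hf a (by simp)).add (ih fun b hb => hf b (by simp [hb]))

/-- Functions of at most linear growth. -/
lemma of_abs_le_linear {f : (ι → ℝ) → ℝ} (hf : Continuous f) {a b : ℝ} (ha : 0 ≤ a) (hb : 0 ≤ b)
    (h : ∀ x, |f x| ≤ a + b * ∑ i, |x i|) : ExpGrowth f := by
  refine ⟨hf, a + b, 1, by positivity, zero_le_one, fun x => (h x).trans ?_⟩
  have hs : 0 ≤ ∑ i, |x i| := Finset.sum_nonneg fun i _ => abs_nonneg _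
  rw [one_mul, add_mul]
  have h1 : 1 ≤ Real.exp (∑ i, |x i|) := Real.one_le_exp hs
  have h2 : ∑ i, |x i| ≤ Real.exp (∑ i, |x i|) := by
    linarith [Real.add_one_le_exp (∑ i, |x i|)]
  nlinarith

lemma exp_of_abs_le_linear {f : (ι → ℝ) → ℝ} (hf : Continuous f) {a b : ℝ} (hb : 0 ≤ b)
    (h : ∀ x, |f x| ≤ a + b * ∑ i, |x i|) : ExpGrowth fun x => Real.exp (f x) := by
  refine ⟨Real.continuous_exp.comp hf, Real.exp a, b, by positivity, hb, fun x => ?_⟩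
  rw [Real.abs_exp, ← Real.exp_add]
  exact Real.exp_le_exp.2 ((le_abs_self _).trans (h x))

end ExpGrowth

lemma abs_dotProduct_le_sum (w x : ι → ℝ) : |w ⬝ᵥ x| ≤ (∑ i, |w i|) * ∑ i, |x i| := by
  rw [dotProduct, Finset.sum_mul]
  refine (Finset.abs_sum_le_sum_abs _ _).trans (Finset.sum_le_sum fun i _ => ?_)
  rw [abs_mul]
  gcongr
  exact Finset.single_le_sum (f := fun i => |x i|) (fun i _ => abs_nonneg _) (Finset.mem_univ i)

lemma ExpGrowth.dotProduct (w : ι → ℝ) : ExpGrowth fun x => w ⬝ᵥ x :=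
  .of_abs_le_linear (by unfold _root_.dotProduct; fun_prop) le_rfl
    (Finset.sum_nonneg fun i _ => abs_nonneg _) fun x => by
    rw [zero_add]; exact abs_dotProduct_le_sum w x

lemma ExpGrowth.exp_dotProduct (w : ι → ℝ) : ExpGrowth fun x => Real.exp (w ⬝ᵥ x) :=
  .exp_of_abs_le_linear (a := 0) (by unfold _root_.dotProduct; fun_prop)
    (Finset.sum_nonneg fun i _ => abs_nonneg _) fun x => by
    rw [zero_add]; exact abs_dotProduct_le_sum w x

end StdNormal

/-! ### The moment generating function of the norm of a standard Gaussian vector -/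

section NormMGF

variable {ι : Type*} [Fintype ι]

/-- A smooth approximation of the Euclidean norm. -/
def smoothNorm (δ : ℝ) (x : ι → ℝ) : ℝ := √(x ⬝ᵥ x + δ)

lemma dotProduct_self_nonneg_real (x : ι → ℝ) : 0 ≤ x ⬝ᵥ x :=
  Finset.sum_nonneg fun i _ => mul_self_nonneg (x i)

lemma smoothNorm_pos {δ : ℝ} (hδ : 0 < δ) (x : ι → ℝ) : 0 < smoothNorm δ x :=
  Real.sqrt_pos.2 (by linarith [dotProduct_self_nonneg_real x])

lemma smoothNorm_sq {δ : ℝ} (hδ : 0 < δ) (x : ι → ℝ) : smoothNorm δ x ^ 2 = x ⬝ᵥ x + δ :=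
  Real.sq_sqrt (by linarith [dotProduct_self_nonneg_real x])

lemma continuous_smoothNorm (δ : ℝ) : Continuous (smoothNorm (ι := ι) δ) := by
  unfold smoothNorm dotProduct; fun_prop

lemma dotProduct_self_le_sq_sum (x : ι → ℝ) : x ⬝ᵥ x ≤ (∑ i, |x i|) ^ 2 := by
  have h := abs_dotProduct_le_sum x x
  rw [← sq] at h
  exact (le_abs_self _).trans h

lemma abs_smoothNorm_le {δ : ℝ} (hδ : 0 < δ) (x : ι → ℝ) :
    |smoothNorm δ x| ≤ √δ + 1 * ∑ i, |x i| := by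
  have hs : 0 ≤ ∑ i, |x i| := Finset.sum_nonneg fun i _ => abs_nonneg _
  rw [abs_of_pos (smoothNorm_pos hδ x), one_mul, add_comm]
  unfold smoothNorm
  refine (Real.sqrt_le_sqrt (add_le_add_left (dotProduct_self_le_sq_sum x) δ)).trans ?_
  refine Real.sqrt_le_iff.2 ⟨by positivity, ?_⟩
  nlinarith [Real.sq_sqrt hδ.le, mul_nonneg hs (Real.sqrt_nonneg δ)]

lemma ExpGrowth.smoothNorm {δ : ℝ} (hδ : 0 < δ) : ExpGrowth (smoothNorm (ι := ι) δ) :=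
  .of_abs_le_linear (continuous_smoothNorm δ) (Real.sqrt_nonneg δ) zero_le_one
    (abs_smoothNorm_le hδ)

lemma ExpGrowth.exp_smoothNorm {δ : ℝ} (hδ : 0 < δ) (t : ℝ) :
    ExpGrowth fun x : ι → ℝ => Real.exp (t * _root_.smoothNorm δ x) :=
  .exp_of_abs_le_linear (a := |t| * √δ) (b := |t|) ((continuous_smoothNorm δ).const_mul t)
    (abs_nonneg t) fun x => by
    rw [abs_mul]
    calc |t| * |_root_.smoothNorm δ x| ≤ |t| * (√δ + 1 * ∑ i, |x i|) :=
          mul_le_mul_of_nonneg_left (abs_smoothNorm_le hδ x) (abs_nonneg t)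
      _ = _ := by ring

lemma ExpGrowth.coord (i : ι) : ExpGrowth fun x : ι → ℝ => x i := by
  classical
  have := ExpGrowth.dotProduct (Pi.single i (1 : ℝ))
  simpa using this

lemma hasLineDerivAt_mul_exp_smoothNorm [DecidableEq ι] {δ : ℝ} (hδ : 0 < δ) (t : ℝ) (i : ι)
    (x : ι → ℝ) :
    HasLineDerivAt ℝ (fun x : ι → ℝ => x i * Real.exp (t * smoothNorm δ x))
      (Real.exp (t * smoothNorm δ x) + t * (x i * x i / smoothNorm δ x *
        Real.exp (t * smoothNorm δ x))) x (Pi.single i 1) := by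
  unfold HasLineDerivAt
  have hr := smoothNorm_pos hδ x
  have hpoly : HasDerivAt (fun s : ℝ => (x + s • Pi.single i 1) ⬝ᵥ (x + s • Pi.single i 1) + δ)
      (2 * x i) 0 := by
    have : (fun s : ℝ => (x + s • Pi.single i 1) ⬝ᵥ (x + s • Pi.single i 1) + δ) =
        fun s => s * (2 * x i) + s ^ 2 + (x ⬝ᵥ x + δ) := by
      funext s
      simp only [add_dotProduct, dotProduct_add, smul_dotProduct, dotProduct_smul, smul_eq_mul,
        dotProduct_single_one, single_one_dotProduct, Pi.add_apply, Pi.smul_apply, Pi.single_eq_same]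
      ring
    rw [this]
    refine ((((hasDerivAt_id (0 : ℝ)).mul_const (2 * x i)).add
      ((hasDerivAt_id (0 : ℝ)).pow 2)).add_const (x ⬝ᵥ x + δ)).congr_deriv ?_
    simp
  have hnorm : HasDerivAt (fun s : ℝ => smoothNorm δ (x + s • Pi.single i 1))
      (x i / smoothNorm δ x) 0 := by
    refine (hpoly.sqrt ?_).congr_deriv ?_
    · simp only [zero_smul, add_zero]
      linarith [dotProduct_self_nonneg_real x]
    · simp only [zero_smul, add_zero]
      change 2 * x i / (2 * smoothNorm δ x) = _
      field_simp
  have hcoord : HasDerivAt (fun s : ℝ => (x + s • (Pi.single i 1 : ι → ℝ)) i) 1 0 := by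
    have : (fun s : ℝ => (x + s • (Pi.single i 1 : ι → ℝ)) i) = fun s => x i + s := by
      funext s; simp
    rw [this]
    exact (hasDerivAt_id _).const_add _
  refine (hcoord.mul (hnorm.const_mul t).exp).congr_deriv ?_
  simp only [zero_smul, add_zero]
  ring

/-- Gaussian integration by parts for `x i * exp (t r)`, with `r` the smoothed norm, summed over
`i`. The derivative of the exponential produces `t (x ⬝ᵥ x) / r`, which is at most `t r`; the
summand `δ` of `r²` is added separately. -/
lemma integral_smoothNorm_sq_mul_exp_le {δ t : ℝ} (hδ : 0 < δ) (ht : 0 ≤ t) :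
    ∫ x, smoothNorm δ x ^ 2 * Real.exp (t * smoothNorm δ x) ∂stdNormal ι ≤
      (Fintype.card ι + δ) * ∫ x, Real.exp (t * smoothNorm δ x) ∂stdNormal ι
        + t * ∫ x, smoothNorm δ x * Real.exp (t * smoothNorm δ x) ∂stdNormal ι := by
  classical
  have hE := ExpGrowth.exp_smoothNorm (ι := ι) hδ t
  have hR := ExpGrowth.smoothNorm (ι := ι) hδ
  have hquot (i : ι) : ExpGrowth fun x : ι → ℝ => x i * x i / smoothNorm δ x := by
    refine (((ExpGrowth.coord i).mul (ExpGrowth.coord i)).const_mul (1 / √δ)).of_abs_le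
      (by
        have := continuous_smoothNorm (ι := ι) δ
        exact (by fun_prop : Continuous fun x : ι → ℝ => x i * x i).div₀ this
          fun x => (smoothNorm_pos hδ x).ne') fun x => ?_
    have hle : √δ ≤ smoothNorm δ x :=
      Real.sqrt_le_sqrt (by linarith [dotProduct_self_nonneg_real x])
    have hδ' : 0 < √δ := Real.sqrt_pos.2 hδ
    rw [abs_div, abs_mul (1 / √δ), abs_of_pos (smoothNorm_pos hδ x),
      abs_of_pos (one_div_pos.2 hδ'), div_eq_mul_inv, mul_comm, one_div]
    gcongr
  have hibp (i : ι) : ∫ x, x i * (x i * Real.exp (t * smoothNorm δ x)) ∂stdNormal ι =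
      ∫ x, (Real.exp (t * smoothNorm δ x) + t * (x i * x i / smoothNorm δ x *
        Real.exp (t * smoothNorm δ x))) ∂stdNormal ι := by
    have h := stdNormal_integral_by_parts (Pi.single i 1)
      (hasLineDerivAt_mul_exp_smoothNorm hδ t i)
      ((ExpGrowth.coord i).mul hE).integrable
      (hE.add (((hquot i).mul hE).const_mul t)).integrable
      (((ExpGrowth.dotProduct _).mul ((ExpGrowth.coord i).mul hE)).integrable)
    simpa using h
  have hsum := Finset.sum_congr (rfl : (Finset.univ : Finset ι) = Finset.univ) fun i _ => hibp i
  rw [← integral_finsetSum _ fun i _ =>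
      ((ExpGrowth.coord i).mul ((ExpGrowth.coord i).mul hE)).integrable,
    ← integral_finsetSum _ fun i _ => (hE.add (((hquot i).mul hE).const_mul t)).integrable] at hsum
  have hlhs : ∫ x, smoothNorm δ x ^ 2 * Real.exp (t * smoothNorm δ x) ∂stdNormal ι =
      (∫ x, ∑ i, x i * (x i * Real.exp (t * smoothNorm δ x)) ∂stdNormal ι)
        + δ * ∫ x, Real.exp (t * smoothNorm δ x) ∂stdNormal ι := by
    rw [← integral_const_mul, ← integral_add
      (ExpGrowth.sum _ fun i _ =>
        (ExpGrowth.coord i).mul ((ExpGrowth.coord i).mul hE)).integrable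
      (hE.const_mul δ).integrable]
    refine integral_congr_ae (Filter.Eventually.of_forall fun x => ?_)
    simp only [smoothNorm_sq hδ, ← mul_assoc, ← Finset.sum_mul, dotProduct]
    ring
  have hrhs : ∫ x, ∑ i, (Real.exp (t * smoothNorm δ x) + t * (x i * x i / smoothNorm δ x *
        Real.exp (t * smoothNorm δ x))) ∂stdNormal ι ≤
      Fintype.card ι * ∫ x, Real.exp (t * smoothNorm δ x) ∂stdNormal ι
        + t * ∫ x, smoothNorm δ x * Real.exp (t * smoothNorm δ x) ∂stdNormal ι := by
    rw [← integral_const_mul, ← integral_const_mul, ← integral_add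
      (hE.const_mul _).integrable ((hR.mul hE).const_mul t).integrable]
    refine integral_mono
      (ExpGrowth.sum _ fun i _ => hE.add (((hquot i).mul hE).const_mul t)).integrable
      ((hE.const_mul _).add ((hR.mul hE).const_mul t)).integrable fun x => ?_
    simp only [Finset.sum_add_distrib, Finset.sum_const, Finset.card_univ, nsmul_eq_mul,
      ← Finset.mul_sum, ← Finset.sum_mul, ← Finset.sum_div]
    gcongr
    rw [div_le_iff₀ (smoothNorm_pos hδ x), ← sq, smoothNorm_sq hδ]
    simp only [dotProduct]
    linarith
  rw [hlhs, hsum]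
  linarith

/-- The derivative `q` of the cumulant generating function is the mean of `r` under the measure
tilted by `exp (t r)`. Nonnegativity of the tilted variance and the preceding second moment bound
give `q² ≤ (n + δ) + t q`, which forces `q ≤ √(n + δ) + t`. -/
lemma deriv_cgf_smoothNorm_le {δ t : ℝ} (hδ : 0 < δ) (ht : 0 ≤ t) :
    deriv (cgf (smoothNorm (ι := ι) δ) (stdNormal ι)) t ≤ √(Fintype.card ι + δ) + t := by
  have hE := ExpGrowth.exp_smoothNorm (ι := ι) hδ t
  have hR := ExpGrowth.smoothNorm (ι := ι) hδ
  have hset : integrableExpSet (smoothNorm (ι := ι) δ) (stdNormal ι) = Set.univ :=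
    Set.eq_univ_of_forall fun s => (ExpGrowth.exp_smoothNorm hδ s).integrable
  rw [deriv_cgf (by simp [hset])]
  set m := mgf (smoothNorm (ι := ι) δ) (stdNormal ι) t with hm
  set m' := ∫ x, smoothNorm δ x * Real.exp (t * smoothNorm δ x) ∂stdNormal ι with hm'
  have hmpos : 0 < m := mgf_pos hE.integrable
  have hkey := integral_smoothNorm_sq_mul_exp_le (ι := ι) hδ ht
  rw [← hm'] at hkey
  set q := m' / m with hq
  have hvar : 0 ≤ ∫ x, (smoothNorm δ x - q) ^ 2 * Real.exp (t * smoothNorm δ x) ∂stdNormal ι :=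
    integral_nonneg fun x => by positivity
  have hexp : ∫ x, (smoothNorm δ x - q) ^ 2 * Real.exp (t * smoothNorm δ x) ∂stdNormal ι =
      (∫ x, smoothNorm δ x ^ 2 * Real.exp (t * smoothNorm δ x) ∂stdNormal ι) + (-2 * q) * m'
        + q ^ 2 * m := by
    have e2 : ExpGrowth fun x : ι → ℝ => smoothNorm δ x ^ 2 * Real.exp (t * smoothNorm δ x) := by
      simpa only [sq] using (hR.mul hR).mul hE
    rw [hm', hm, mgf, ← integral_const_mul, ← integral_const_mul,
      ← integral_add e2.integrable ((hR.mul hE).const_mul _).integrable, ← integral_add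
      (e2.add ((hR.mul hE).const_mul _)).integrable (hE.const_mul _).integrable]
    refine integral_congr_ae (Filter.Eventually.of_forall fun x => ?_)
    ring
  have hm'q : m' = q * m := by rw [hq]; field_simp
  rw [hexp, hm'q] at hvar
  have hm2 : ∫ x, Real.exp (t * smoothNorm δ x) ∂stdNormal ι = m := rfl
  rw [hm2, hm'q] at hkey
  have hquad : q ^ 2 ≤ (Fintype.card ι + δ) + t * q := by
    have : q ^ 2 * m ≤ ((Fintype.card ι + δ) + t * q) * m := by nlinarith
    exact le_of_mul_le_mul_right this hmpos
  have hs := Real.sq_sqrt (show (0 : ℝ) ≤ Fintype.card ι + δ by positivity)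
  have hs0 := Real.sqrt_nonneg ((Fintype.card ι : ℝ) + δ)
  by_contra! hcon
  nlinarith

/-- Integrate the derivative bound from `0`, where the cumulant generating function vanishes. -/
lemma mgf_smoothNorm_le {δ t : ℝ} (hδ : 0 < δ) (ht : 0 ≤ t) :
    mgf (smoothNorm (ι := ι) δ) (stdNormal ι) t ≤
      Real.exp (t * √(Fintype.card ι + δ) + t ^ 2 / 2) := by
  have hset : integrableExpSet (smoothNorm (ι := ι) δ) (stdNormal ι) = Set.univ :=
    Set.eq_univ_of_forall fun s => (ExpGrowth.exp_smoothNorm hδ s).integrable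
  have hint (s : ℝ) : s ∈ interior (integrableExpSet (smoothNorm (ι := ι) δ) (stdNormal ι)) := by
    simp [hset]
  have hdiff (s : ℝ) : HasDerivAt (cgf (smoothNorm (ι := ι) δ) (stdNormal ι))
      (deriv (cgf (smoothNorm (ι := ι) δ) (stdNormal ι)) s) s :=
    (analyticAt_cgf (hint s)).differentiableAt.hasDerivAt
  set g := cgf (smoothNorm (ι := ι) δ) (stdNormal ι) with hg
  have hmono : MonotoneOn (fun s => s * √(Fintype.card ι + δ) + s ^ 2 / 2 - g s) (Set.Ici 0) := by
    have hd (s : ℝ) : HasDerivAt (fun s => s * √(Fintype.card ι + δ) + s ^ 2 / 2 - g s)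
        (√(Fintype.card ι + δ) + s - deriv g s) s := by
      refine ((((hasDerivAt_id s).mul_const _).add
        (((hasDerivAt_id s).pow 2).div_const 2)).sub (hdiff s)).congr_deriv ?_
      simp
    refine monotoneOn_of_deriv_nonneg (convex_Ici 0)
      (fun s _ => (hd s).continuousAt.continuousWithinAt)
      (fun s _ => (hd s).differentiableAt.differentiableWithinAt) fun s hs => ?_
    rw [(hd s).deriv]
    rw [interior_Ici] at hs
    linarith [deriv_cgf_smoothNorm_le (ι := ι) hδ (le_of_lt hs)]
  have h := hmono (Set.mem_Ici.2 le_rfl) (Set.mem_Ici.2 ht) ht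
  simp only [zero_mul, hg, cgf_zero] at h
  rw [← exp_cgf (ExpGrowth.exp_smoothNorm hδ t).integrable]
  refine Real.exp_le_exp.2 ?_
  linarith

/-- The norm of a standard Gaussian vector is sub-Gaussian around `√n`. -/
lemma integral_exp_norm_le {t : ℝ} (ht : 0 ≤ t) :
    ∫ x, Real.exp (t * √(x ⬝ᵥ x)) ∂stdNormal ι ≤
      Real.exp (t * √(Fintype.card ι) + t ^ 2 / 2) := by
  have hbound : ∀ δ : ℝ, 0 < δ → ∫ x, Real.exp (t * √(x ⬝ᵥ x)) ∂stdNormal ι ≤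
      Real.exp (t * √(Fintype.card ι + δ) + t ^ 2 / 2) := fun δ hδ => by
    refine le_trans ?_ (mgf_smoothNorm_le hδ ht)
    have hE := ExpGrowth.exp_smoothNorm (ι := ι) hδ t
    refine integral_mono_of_nonneg (Filter.Eventually.of_forall fun x => by positivity)
      hE.integrable (Filter.Eventually.of_forall fun x => ?_)
    simp only [smoothNorm]
    gcongr
    linarith
  have hlim : Filter.Tendsto (fun δ : ℝ => Real.exp (t * √(Fintype.card ι + δ) + t ^ 2 / 2))
      (nhdsWithin 0 (Set.Ioi 0)) (nhds (Real.exp (t * √(Fintype.card ι) + t ^ 2 / 2))) := by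
    have : Continuous fun δ : ℝ => Real.exp (t * √(Fintype.card ι + δ) + t ^ 2 / 2) := by fun_prop
    have h := this.tendsto 0
    rw [add_zero] at h
    exact h.mono_left nhdsWithin_le_nhds
  exact ge_of_tendsto hlim (eventually_nhdsWithin_of_forall fun δ hδ => hbound δ hδ)

end NormMGF

/-! ### A Gaussian comparison inequality for moment generating functions of maxima -/

section Comparison

variable {ι I : Type*} [Fintype ι] [Fintype I]

/-- The partition function `∑ₐ exp (β ⟨zₐ, ζ⟩)`. -/
def partitionFun (β : ℝ) (z : I → ι → ℝ) (ζ : ι → ℝ) : ℝ := ∑ a, Real.exp (β * (z a ⬝ᵥ ζ))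

lemma exp_le_partitionFun (β : ℝ) (z : I → ι → ℝ) (ζ : ι → ℝ) (a : I) :
    Real.exp (β * (z a ⬝ᵥ ζ)) ≤ partitionFun β z ζ :=
  Finset.single_le_sum (f := fun a => Real.exp (β * (z a ⬝ᵥ ζ)))
    (fun _ _ => (Real.exp_pos _).le) (Finset.mem_univ a)

lemma partitionFun_pos [Nonempty I] (β : ℝ) (z : I → ι → ℝ) (ζ : ι → ℝ) :
    0 < partitionFun β z ζ :=
  Finset.sum_pos (fun _ _ => Real.exp_pos _) Finset.univ_nonempty

lemma ExpGrowth.exp_mul_dotProduct (β : ℝ) (w : ι → ℝ) :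
    ExpGrowth fun ζ => Real.exp (β * (w ⬝ᵥ ζ)) := by
  simpa only [smul_dotProduct, smul_eq_mul] using ExpGrowth.exp_dotProduct (β • w)

lemma ExpGrowth.partitionFun (β : ℝ) (z : I → ι → ℝ) : ExpGrowth (partitionFun β z) :=
  ExpGrowth.sum _ fun a _ => ExpGrowth.exp_mul_dotProduct β (z a)

lemma rpow_le_one_add {s κ : ℝ} (hs : 0 < s) (hκ : 0 ≤ κ) (hκ1 : κ ≤ 1) : s ^ κ ≤ 1 + s := by
  rcases le_total s 1 with h | h
  · linarith [Real.rpow_le_one hs.le h hκ]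
  · have := Real.rpow_le_rpow_of_exponent_le h hκ1
    rw [Real.rpow_one] at this
    linarith

lemma continuous_partitionFun_rpow [Nonempty I] (β κ : ℝ) (z : I → ι → ℝ) :
    Continuous fun ζ => partitionFun β z ζ ^ κ :=
  (ExpGrowth.partitionFun β z).1.rpow_const fun ζ => Or.inl (partitionFun_pos β z ζ).ne'

lemma ExpGrowth.partitionFun_rpow [Nonempty I] (β : ℝ) {κ : ℝ} (hκ : 0 ≤ κ) (hκ1 : κ ≤ 1)
    (z : I → ι → ℝ) : ExpGrowth fun ζ => _root_.partitionFun β z ζ ^ κ := by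
  refine ((ExpGrowth.const 1).add (ExpGrowth.partitionFun β z)).of_abs_le
    (continuous_partitionFun_rpow β κ z) fun ζ => ?_
  have hS := partitionFun_pos β z ζ
  rw [abs_of_pos (Real.rpow_pos_of_pos hS κ), abs_of_pos (by linarith)]
  exact rpow_le_one_add hS hκ hκ1

/-- Each exponential is one summand of the partition function, so it absorbs one negative power.
This keeps the exponents `κ - 1` and `κ - 2` that arise from differentiation within exponential
growth. -/
lemma partitionFun_rpow_sub_one_mul_exp_le [Nonempty I] (β κ : ℝ) (z : I → ι → ℝ) (ζ : ι → ℝ)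
    (a : I) :
    partitionFun β z ζ ^ (κ - 1) * Real.exp (β * (z a ⬝ᵥ ζ)) ≤ partitionFun β z ζ ^ κ := by
  have hS := partitionFun_pos β z ζ
  calc partitionFun β z ζ ^ (κ - 1) * Real.exp (β * (z a ⬝ᵥ ζ))
      ≤ partitionFun β z ζ ^ (κ - 1) * partitionFun β z ζ := by
        gcongr; exact exp_le_partitionFun β z ζ a
    _ = partitionFun β z ζ ^ κ := by
        rw [← Real.rpow_add_one hS.ne', sub_add_cancel]

lemma ExpGrowth.partitionFun_rpow_mul_exp [Nonempty I] (β : ℝ) {κ : ℝ} (hκ : 0 ≤ κ) (hκ1 : κ ≤ 1)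
    (z : I → ι → ℝ) (a : I) :
    ExpGrowth fun ζ => _root_.partitionFun β z ζ ^ (κ - 1) * Real.exp (β * (z a ⬝ᵥ ζ)) := by
  refine (ExpGrowth.partitionFun_rpow β hκ hκ1 z).of_abs_le
    ((continuous_partitionFun_rpow β _ z).mul (ExpGrowth.exp_mul_dotProduct β (z a)).1) fun ζ => ?_
  have hS := partitionFun_pos β z ζ
  rw [abs_of_pos (by positivity), abs_of_pos (by positivity)]
  exact partitionFun_rpow_sub_one_mul_exp_le β κ z ζ a

lemma ExpGrowth.partitionFun_rpow_mul_exp_mul_exp [Nonempty I] (β : ℝ) {κ : ℝ} (hκ : 0 ≤ κ)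
    (hκ1 : κ ≤ 1) (z : I → ι → ℝ) (a b : I) :
    ExpGrowth fun ζ => _root_.partitionFun β z ζ ^ (κ - 1 - 1) * Real.exp (β * (z b ⬝ᵥ ζ))
      * Real.exp (β * (z a ⬝ᵥ ζ)) := by
  refine (ExpGrowth.partitionFun_rpow β hκ hκ1 z).of_abs_le
    (((continuous_partitionFun_rpow β _ z).mul (ExpGrowth.exp_mul_dotProduct β (z b)).1).mul
      (ExpGrowth.exp_mul_dotProduct β (z a)).1) fun ζ => ?_
  have hS := partitionFun_pos β z ζ
  rw [abs_of_pos (by positivity), abs_of_pos (by positivity)]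
  refine le_trans ?_ (partitionFun_rpow_sub_one_mul_exp_le β κ z ζ a)
  gcongr
  exact partitionFun_rpow_sub_one_mul_exp_le β (κ - 1) z ζ b

lemma hasLineDerivAt_exp_mul_dotProduct (β : ℝ) (v ζ w : ι → ℝ) :
    HasLineDerivAt ℝ (fun ζ => Real.exp (β * (v ⬝ᵥ ζ)))
      (β * (v ⬝ᵥ w) * Real.exp (β * (v ⬝ᵥ ζ))) ζ w := by
  unfold HasLineDerivAt
  have : (fun t : ℝ => Real.exp (β * (v ⬝ᵥ (ζ + t • w)))) =
      fun t => Real.exp (t * (β * (v ⬝ᵥ w)) + β * (v ⬝ᵥ ζ)) := by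
    funext t
    simp only [dotProduct_add, dotProduct_smul, smul_eq_mul]
    ring_nf
  rw [this]
  refine (((hasDerivAt_id (0 : ℝ)).mul_const (β * (v ⬝ᵥ w))).add_const
    (β * (v ⬝ᵥ ζ))).exp.congr_deriv ?_
  simp
  ring

lemma hasLineDerivAt_partitionFun_rpow_mul_exp [Nonempty I] (β κ : ℝ) (z : I → ι → ℝ) (a : I)
    (ζ w : ι → ℝ) :
    HasLineDerivAt ℝ (fun ζ => partitionFun β z ζ ^ (κ - 1) * Real.exp (β * (z a ⬝ᵥ ζ)))
      (∑ b, (κ - 1) * (β * (z b ⬝ᵥ w)) * (partitionFun β z ζ ^ (κ - 1 - 1)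
          * Real.exp (β * (z b ⬝ᵥ ζ)) * Real.exp (β * (z a ⬝ᵥ ζ)))
        + β * (z a ⬝ᵥ w) * (partitionFun β z ζ ^ (κ - 1) * Real.exp (β * (z a ⬝ᵥ ζ)))) ζ w := by
  have hS := partitionFun_pos β z ζ
  have h1 := HasDerivAt.fun_sum (u := Finset.univ) fun (b : I) _ =>
    hasLineDerivAt_exp_mul_dotProduct β (z b) ζ w
  have h2 := h1.rpow_const (p := κ - 1) (Or.inl (by
    simp only [zero_smul, add_zero]; exact hS.ne'))
  refine (h2.mul (hasLineDerivAt_exp_mul_dotProduct β (z a) ζ w)).congr_deriv ?_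
  simp only [zero_smul, add_zero]
  change _ * (κ - 1) * partitionFun β z ζ ^ (κ - 1 - 1) * _ + partitionFun β z ζ ^ (κ - 1) * _ = _
  rw [Finset.sum_mul, Finset.sum_mul, Finset.sum_mul]
  congr 1
  · exact Finset.sum_congr rfl fun b _ => by ring
  · ring

/-- Integration by parts in the direction `w` leaves `w` only in the products `z b ⬝ᵥ w`. The sum
over `b` has the nonpositive factor `κ - 1`, which fixes the sign in the comparison. -/
lemma integral_dotProduct_mul_partitionFun_rpow [Nonempty I] (β : ℝ) {κ : ℝ} (hκ : 0 ≤ κ)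
    (hκ1 : κ ≤ 1) (z : I → ι → ℝ) (a : I) (w : ι → ℝ) :
    ∫ ζ, (w ⬝ᵥ ζ) * (partitionFun β z ζ ^ (κ - 1) * Real.exp (β * (z a ⬝ᵥ ζ))) ∂stdNormal ι =
      ∑ b, (κ - 1) * (β * (z b ⬝ᵥ w)) * ∫ ζ, partitionFun β z ζ ^ (κ - 1 - 1)
          * Real.exp (β * (z b ⬝ᵥ ζ)) * Real.exp (β * (z a ⬝ᵥ ζ)) ∂stdNormal ι
        + β * (z a ⬝ᵥ w) *
          ∫ ζ, partitionFun β z ζ ^ (κ - 1) * Real.exp (β * (z a ⬝ᵥ ζ)) ∂stdNormal ι := by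
  have hG := ExpGrowth.partitionFun_rpow_mul_exp β hκ hκ1 z a
  have hD (b : I) := (ExpGrowth.partitionFun_rpow_mul_exp_mul_exp β hκ hκ1 z a b).const_mul
    ((κ - 1) * (β * (z b ⬝ᵥ w)))
  have hsum := ExpGrowth.sum Finset.univ fun b _ => hD b
  rw [stdNormal_integral_by_parts w
    (fun ζ => hasLineDerivAt_partitionFun_rpow_mul_exp β κ z a ζ w) hG.integrable
    (hsum.add (hG.const_mul _)).integrable ((ExpGrowth.dotProduct w).mul hG).integrable,
    integral_add hsum.integrable (hG.const_mul _).integrable,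
    integral_finsetSum _ fun b _ => (hD b).integrable]
  simp only [integral_const_mul]

/-- The interpolation between two families of vectors along a quarter circle. -/
def arcPath (x y : I → ι → ℝ) (θ : ℝ) (a : I) : ι → ℝ := Real.cos θ • x a + Real.sin θ • y a

lemma arcPath_dotProduct {I : Type*} (x y : I → ι → ℝ) (θ : ℝ) (a : I) (ζ : ι → ℝ) :
    arcPath x y θ a ⬝ᵥ ζ = Real.cos θ * (x a ⬝ᵥ ζ) + Real.sin θ * (y a ⬝ᵥ ζ) := by
  simp [arcPath, add_dotProduct]

lemma abs_arcPath_dotProduct_le (x y : I → ι → ℝ) (θ : ℝ) (a : I) (ζ : ι → ℝ) :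
    |arcPath x y θ a ⬝ᵥ ζ| ≤ (∑ a, ∑ i, (|x a i| + |y a i|)) * ∑ i, |ζ i| := by
  refine (abs_dotProduct_le_sum _ _).trans ?_
  gcongr
  refine le_trans (Finset.sum_le_sum fun i _ => ?_)
    (Finset.single_le_sum (f := fun a => ∑ i, (|x a i| + |y a i|))
      (fun a _ => Finset.sum_nonneg fun i _ => by positivity) (Finset.mem_univ a))
  simp only [arcPath, Pi.add_apply, Pi.smul_apply, smul_eq_mul]
  refine (abs_add_le _ _).trans ?_
  rw [abs_mul, abs_mul]
  have h1 := Real.abs_cos_le_one θ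
  have h2 := Real.abs_sin_le_one θ
  nlinarith [abs_nonneg (x a i), abs_nonneg (y a i)]

/-- The velocity on a quarter circle is the position advanced by `π / 2`, so it is again an
`arcPath`. -/
lemma hasDerivAt_arcPath_dotProduct {I : Type*} (x y : I → ι → ℝ) (θ : ℝ) (a : I) (ζ : ι → ℝ) :
    HasDerivAt (fun θ => arcPath x y θ a ⬝ᵥ ζ)
      (arcPath x y (θ + Real.pi / 2) a ⬝ᵥ ζ) θ := by
  simp only [arcPath_dotProduct, Real.cos_add_pi_div_two, Real.sin_add_pi_div_two]
  exact ((Real.hasDerivAt_cos θ).mul_const _).add ((Real.hasDerivAt_sin θ).mul_const _)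

lemma hasDerivAt_partitionFun_arcPath [Nonempty I] (β κ : ℝ) (x y : I → ι → ℝ) (θ : ℝ)
    (ζ : ι → ℝ) :
    HasDerivAt (fun θ => partitionFun β (arcPath x y θ) ζ ^ κ)
      (∑ a, κ * β * ((arcPath x y (θ + Real.pi / 2) a ⬝ᵥ ζ) *
        (partitionFun β (arcPath x y θ) ζ ^ (κ - 1) *
          Real.exp (β * (arcPath x y θ a ⬝ᵥ ζ))))) θ := by
  have hS := partitionFun_pos β (arcPath x y θ) ζ
  have h1 := HasDerivAt.fun_sum (u := Finset.univ) fun (a : I) _ =>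
    ((hasDerivAt_arcPath_dotProduct x y θ a ζ).const_mul β).exp
  refine (h1.rpow_const (p := κ) (Or.inl hS.ne')).congr_deriv ?_
  change _ * κ * partitionFun β (arcPath x y θ) ζ ^ (κ - 1) = _
  rw [Finset.sum_mul, Finset.sum_mul]
  exact Finset.sum_congr rfl fun b _ => by ring

lemma hasDerivAt_integral_partitionFun_arcPath [Nonempty I] {β κ : ℝ} (hβ : 0 ≤ β) (hκ : 0 ≤ κ)
    (hκ1 : κ ≤ 1) (x y : I → ι → ℝ) (θ : ℝ) :
    HasDerivAt (fun θ => ∫ ζ, partitionFun β (arcPath x y θ) ζ ^ κ ∂stdNormal ι)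
      (∑ a, κ * β * ∫ ζ, (arcPath x y (θ + Real.pi / 2) a ⬝ᵥ ζ) *
        (partitionFun β (arcPath x y θ) ζ ^ (κ - 1) *
          Real.exp (β * (arcPath x y θ a ⬝ᵥ ζ))) ∂stdNormal ι) θ := by
  set M : ℝ := ∑ a, ∑ i, (|x a i| + |y a i|) with hM
  have hM0 : 0 ≤ M := Finset.sum_nonneg fun a _ => Finset.sum_nonneg fun i _ => by positivity
  have hterm (θ : ℝ) (a : I) : ExpGrowth fun ζ => κ * β *
      ((arcPath x y (θ + Real.pi / 2) a ⬝ᵥ ζ) * (partitionFun β (arcPath x y θ) ζ ^ (κ - 1) *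
          Real.exp (β * (arcPath x y θ a ⬝ᵥ ζ)))) :=
    ((ExpGrowth.dotProduct _).mul
      (ExpGrowth.partitionFun_rpow_mul_exp β hκ hκ1 (arcPath x y θ) a)).const_mul _
  have hL : ExpGrowth fun ζ : ι → ℝ => M * ∑ i, |ζ i| :=
    .of_abs_le_linear (by fun_prop) le_rfl hM0 fun ζ => by
      rw [abs_of_nonneg (mul_nonneg hM0 (Finset.sum_nonneg fun i _ => abs_nonneg _)), zero_add]
  have hexpL : ExpGrowth fun ζ : ι → ℝ => Real.exp (β * (M * ∑ i, |ζ i|)) :=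
    .exp_of_abs_le_linear (a := 0) (b := β * M) (by fun_prop) (by positivity) fun ζ => by
      rw [abs_of_nonneg (by positivity), zero_add, mul_assoc]
  -- A majorant of the derivative uniform in `θ`: every `arcPath` form is at most `M * ∑ i, |ζ i|`
  -- in absolute value.
  have hbound : ExpGrowth fun ζ : ι → ℝ => ∑ _a : I, κ * β * ((M * ∑ i, |ζ i|) *
      (1 + ∑ _b : I, Real.exp (β * (M * ∑ i, |ζ i|)))) :=
    ExpGrowth.sum _ fun a _ => (hL.mul ((ExpGrowth.const 1).add
      (ExpGrowth.sum _ fun b _ => hexpL))).const_mul _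
  have h := hasDerivAt_integral_of_dominated_loc_of_deriv_le (μ := stdNormal ι)
    (F := fun θ ζ => partitionFun β (arcPath x y θ) ζ ^ κ) (x₀ := θ) (s := Set.univ)
    Filter.univ_mem
    (Filter.Eventually.of_forall fun θ =>
      (continuous_partitionFun_rpow β κ (arcPath x y θ)).aestronglyMeasurable)
    (ExpGrowth.partitionFun_rpow β hκ hκ1 (arcPath x y θ)).integrable
    (ExpGrowth.sum Finset.univ fun a _ => hterm θ a).1.aestronglyMeasurable
    (Filter.Eventually.of_forall fun ζ θ _ => by
      rw [Real.norm_eq_abs]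
      refine (Finset.abs_sum_le_sum_abs _ _).trans (Finset.sum_le_sum fun a _ => ?_)
      have hS := partitionFun_pos β (arcPath x y θ) ζ
      rw [abs_mul (κ * β), abs_mul (_ ⬝ᵥ _), abs_of_nonneg (mul_nonneg hκ hβ), abs_of_pos
        (mul_pos (Real.rpow_pos_of_pos hS _) (Real.exp_pos _))]
      have h1 := abs_arcPath_dotProduct_le x y (θ + Real.pi / 2) a ζ
      have h2 : partitionFun β (arcPath x y θ) ζ ^ (κ - 1) *
          Real.exp (β * (arcPath x y θ a ⬝ᵥ ζ)) ≤
          1 + ∑ _b : I, Real.exp (β * (M * ∑ i, |ζ i|)) := by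
        refine (partitionFun_rpow_sub_one_mul_exp_le β κ _ ζ a).trans
          ((rpow_le_one_add hS hκ hκ1).trans ?_)
        unfold partitionFun
        gcongr with b
        exact (le_abs_self _).trans (abs_arcPath_dotProduct_le x y θ b ζ)
      gcongr)
    hbound.integrable
    (Filter.Eventually.of_forall fun ζ θ _ => hasDerivAt_partitionFun_arcPath β κ x y θ ζ)
  refine h.2.congr_deriv ?_
  rw [integral_finsetSum _ fun a _ => (hterm θ a).integrable]
  simp only [integral_const_mul]

/-- Slepian type comparison for powers of partition functions. -/
lemma integral_partitionFun_rpow_le [Nonempty I] {β κ : ℝ} (hβ : 0 ≤ β) (hκ : 0 ≤ κ)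
    (hκ1 : κ ≤ 1) {x y : I → ι → ℝ} (hxy : ∀ a b, x a ⬝ᵥ y b = 0)
    (hdiag : ∀ a, x a ⬝ᵥ x a = y a ⬝ᵥ y a) (hcov : ∀ a b, y a ⬝ᵥ y b ≤ x a ⬝ᵥ x b) :
    ∫ ζ, partitionFun β x ζ ^ κ ∂stdNormal ι ≤ ∫ ζ, partitionFun β y ζ ^ κ ∂stdNormal ι := by
  have hd := hasDerivAt_integral_partitionFun_arcPath hβ hκ hκ1 x y
  have hdot (θ : ℝ) (a b : I) : arcPath x y θ b ⬝ᵥ arcPath x y (θ + Real.pi / 2) a =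
      Real.cos θ * Real.sin θ * (y b ⬝ᵥ y a - x b ⬝ᵥ x a) := by
    have hyx : y b ⬝ᵥ x a = 0 := by rw [dotProduct_comm, hxy]
    simp only [arcPath, Real.cos_add_pi_div_two, Real.sin_add_pi_div_two, add_dotProduct,
      dotProduct_add, smul_dotProduct, dotProduct_smul, smul_eq_mul, hxy, hyx]
    ring
  have hmono : MonotoneOn (fun θ => ∫ ζ, partitionFun β (arcPath x y θ) ζ ^ κ ∂stdNormal ι)
      (Set.Icc 0 (Real.pi / 2)) := by
    refine monotoneOn_of_deriv_nonneg (convex_Icc _ _)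
      (fun s _ => (hd s).continuousAt.continuousWithinAt)
      (fun s _ => (hd s).differentiableAt.differentiableWithinAt) fun θ hθ => ?_
    rw [interior_Icc] at hθ
    rw [(hd θ).deriv]
    have hcs : 0 ≤ Real.cos θ * Real.sin θ :=
      mul_nonneg (Real.cos_nonneg_of_neg_pi_div_two_le_of_le (by linarith [hθ.1, Real.pi_pos])
        hθ.2.le) (Real.sin_nonneg_of_nonneg_of_le_pi hθ.1.le (by linarith [hθ.2, Real.pi_pos]))
    refine Finset.sum_nonneg fun a _ => mul_nonneg (mul_nonneg hκ hβ) ?_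
    -- The products of positions with velocities equal `cos θ sin θ (y b ⬝ᵥ y a - x b ⬝ᵥ x a) ≤ 0`.
    -- Together with `κ - 1 ≤ 0` they make the sum nonnegative; the remaining term is diagonal and
    -- vanishes because the variances agree.
    rw [integral_dotProduct_mul_partitionFun_rpow β hκ hκ1]
    refine add_nonneg (Finset.sum_nonneg fun b _ => ?_) ?_
    · refine mul_nonneg (mul_nonneg_of_nonpos_of_nonpos (by linarith)
        (mul_nonpos_of_nonneg_of_nonpos hβ ?_)) (integral_nonneg fun ζ => ?_)
      · rw [hdot]
        exact mul_nonpos_of_nonneg_of_nonpos hcs (by linarith [hcov b a])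
      · have hS := partitionFun_pos β (arcPath x y θ) ζ
        simp only [Pi.zero_apply]
        positivity
    · rw [hdot, hdiag]
      simp
  have hpi : (0 : ℝ) ≤ Real.pi / 2 := by positivity
  have h := hmono (Set.left_mem_Icc.2 hpi) (Set.right_mem_Icc.2 hpi) hpi
  have h0 : arcPath x y 0 = x := by funext a; simp [arcPath]
  have h1 : arcPath x y (Real.pi / 2) = y := by funext a; simp [arcPath]
  simpa only [h0, h1] using h

/-- Comparison of the moment generating functions of maxima of two Gaussian processes. -/
theorem integral_exp_sup_le [Nonempty I] {t : ℝ} (ht : 0 < t) {x y : I → ι → ℝ}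
    (hxy : ∀ a b, x a ⬝ᵥ y b = 0) (hdiag : ∀ a, x a ⬝ᵥ x a = y a ⬝ᵥ y a)
    (hcov : ∀ a b, y a ⬝ᵥ y b ≤ x a ⬝ᵥ x b) {R : (ι → ℝ) → ℝ} (hR : ∀ a ζ, y a ⬝ᵥ ζ ≤ R ζ)
    (hint : Integrable (fun ζ => Real.exp (t * R ζ)) (stdNormal ι)) :
    ∫ ζ, Real.exp (t * Finset.univ.sup' Finset.univ_nonempty fun a => x a ⬝ᵥ ζ) ∂stdNormal ι ≤
      ∫ ζ, Real.exp (t * R ζ) ∂stdNormal ι := by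
  set c : ℝ := (Fintype.card I : ℝ) with hc
  have hcpos : 0 < c := by rw [hc]; exact_mod_cast Fintype.card_pos
  -- With exponent `κ = t / β`, the power of the partition function dominates `exp (t max)` on the
  -- left and is at most `|I| ^ (t / β) * exp (t R)` on the right. The condition `t ≤ β` ensures `κ
  -- ≤ 1`, and the prefactor tends to `1` as `β → ∞`.
  have hbound : ∀ β : ℝ, t ≤ β →
      ∫ ζ, Real.exp (t * Finset.univ.sup' Finset.univ_nonempty fun a => x a ⬝ᵥ ζ) ∂stdNormal ι ≤
        c ^ (t / β) * ∫ ζ, Real.exp (t * R ζ) ∂stdNormal ι := fun β hβ => by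
    have hβ0 : 0 < β := ht.trans_le hβ
    have hκ : 0 ≤ t / β := by positivity
    have hκ1 : t / β ≤ 1 := (div_le_one hβ0).2 hβ
    rw [← integral_const_mul]
    refine le_trans (integral_mono_of_nonneg (Filter.Eventually.of_forall fun ζ => by positivity)
      (ExpGrowth.partitionFun_rpow β hκ hκ1 x).integrable
      (Filter.Eventually.of_forall fun ζ => ?_))
      ((integral_partitionFun_rpow_le hβ0.le hκ hκ1 hxy hdiag hcov).trans
        (integral_mono (ExpGrowth.partitionFun_rpow β hκ hκ1 y).integrable
          (hint.const_mul _) fun ζ => ?_))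
    · obtain ⟨a, -, ha⟩ := Finset.exists_mem_eq_sup' (Finset.univ_nonempty (α := I))
        fun a => x a ⬝ᵥ ζ
      simp only [ha]
      refine le_trans (le_of_eq ?_) (Real.rpow_le_rpow (Real.exp_pos _).le
        (exp_le_partitionFun β x ζ a) hκ)
      rw [← Real.exp_mul]
      congr 1
      field_simp
    · have hle : partitionFun β y ζ ≤ c * Real.exp (β * R ζ) := by
        rw [hc, ← nsmul_eq_mul, ← Finset.card_univ, ← Finset.sum_const]
        unfold partitionFun
        gcongr with a
        exact hR a ζ
      refine (Real.rpow_le_rpow (partitionFun_pos β y ζ).le hle hκ).trans (le_of_eq ?_)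
      rw [Real.mul_rpow hcpos.le (Real.exp_pos _).le, ← Real.exp_mul]
      congr 2
      field_simp
  have hlim : Filter.Tendsto (fun β : ℝ => c ^ (t / β) * ∫ ζ, Real.exp (t * R ζ) ∂stdNormal ι)
      Filter.atTop (nhds (c ^ (0 : ℝ) * ∫ ζ, Real.exp (t * R ζ) ∂stdNormal ι)) :=
    ((Real.continuous_const_rpow hcpos.ne').tendsto 0 |>.comp
      (tendsto_const_nhds.div_atTop Filter.tendsto_id)).mul_const _
  rw [Real.rpow_zero, one_mul] at hlim
  exact ge_of_tendsto hlim (Filter.eventually_atTop.2 ⟨t, hbound⟩)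

end Comparison

/-! ### A deviation inequality for Gaussian matrices -/

section GaussianMatrix

lemma integral_stdNormal_sum {ι κ : Type*} [Fintype ι] [Fintype κ] (f : (ι → ℝ) → ℝ)
    (g : (κ → ℝ) → ℝ) :
    ∫ x, f (x ∘ Sum.inl) * g (x ∘ Sum.inr) ∂stdNormal (ι ⊕ κ) =
      (∫ x, f x ∂stdNormal ι) * ∫ x, g x ∂stdNormal κ := by
  have h := measurePreserving_sumPiEquivProdPi (X := fun _ : ι ⊕ κ => ℝ)
    fun _ => gaussianReal 0 1
  have h2 := h.integral_comp' fun p : (ι → ℝ) × (κ → ℝ) => f p.1 * g p.2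
  rw [← integral_prod_mul]
  exact h2

lemma sqrt_dotProduct_comp_le {ι κ : Type*} [Fintype ι] [Fintype κ] {j : κ → ι}
    (hj : Function.Injective j) (x : ι → ℝ) : √((x ∘ j) ⬝ᵥ (x ∘ j)) ≤ ∑ i, |x i| := by
  classical
  refine Real.sqrt_le_iff.2 ⟨Finset.sum_nonneg fun i _ => abs_nonneg _, ?_⟩
  refine (dotProduct_self_le_sq_sum _).trans ?_
  have h : ∑ k, |(x ∘ j) k| ≤ ∑ i, |x i| := by
    have := Finset.sum_image (f := fun i => |x i|) (g := j) (s := Finset.univ)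
      fun a _ b _ h => hj h
    simp only [Function.comp_apply]
    rw [← this]
    exact Finset.sum_le_sum_of_subset_of_nonneg (Finset.subset_univ _) fun _ _ _ => abs_nonneg _
  exact pow_le_pow_left₀ (Finset.sum_nonneg fun i _ => abs_nonneg _) h 2

lemma sumElim_dotProduct {κ κ' : Type*} [Fintype κ] [Fintype κ'] (p : κ → ℝ) (q : κ' → ℝ)
    (ζ : κ ⊕ κ' → ℝ) : Sum.elim p q ⬝ᵥ ζ = p ⬝ᵥ (ζ ∘ Sum.inl) + q ⬝ᵥ (ζ ∘ Sum.inr) := by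
  simp [dotProduct, Fintype.sum_sum_type]

lemma dotProduct_le_sqrt_mul_sqrt {ι : Type*} [Fintype ι] (x y : ι → ℝ) :
    x ⬝ᵥ y ≤ √(x ⬝ᵥ x) * √(y ⬝ᵥ y) := by
  have h := Finset.sum_mul_sq_le_sq_mul_sq Finset.univ x y
  rw [← Real.sqrt_mul (dotProduct_self_nonneg_real x)]
  refine Real.le_sqrt_of_sq_le ?_
  simpa only [dotProduct, sq] using h

lemma dotProduct_le_one {ι : Type*} [Fintype ι] {x y : ι → ℝ} (hx : x ⬝ᵥ x = 1)
    (hy : y ⬝ᵥ y = 1) : x ⬝ᵥ y ≤ 1 := by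
  simpa [hx, hy] using dotProduct_le_sqrt_mul_sqrt x y

lemma dotProduct_le_sqrt {ι : Type*} [Fintype ι] {x : ι → ℝ} (hx : x ⬝ᵥ x = 1) (y : ι → ℝ) :
    x ⬝ᵥ y ≤ √(y ⬝ᵥ y) := by
  simpa [hx] using dotProduct_le_sqrt_mul_sqrt x y

variable {m n : Type*} [Fintype m] [Fintype n]

/-- The coefficients of the rank one matrix `u wᵀ`. -/
def rankOneVec (u : m → ℝ) (w : n → ℝ) : m × n → ℝ := fun p => u p.1 * w p.2

lemma rankOneVec_dotProduct (u : m → ℝ) (w : n → ℝ) (ζ : m × n → ℝ) :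
    rankOneVec u w ⬝ᵥ ζ = u ⬝ᵥ (Matrix.of fun i j => ζ (i, j)) *ᵥ w := by
  simp only [rankOneVec, dotProduct, Matrix.mulVec, Fintype.sum_prod_type, Finset.mul_sum,
    Matrix.of_apply]
  exact Finset.sum_congr rfl fun i _ => Finset.sum_congr rfl fun j _ => by ring

lemma rankOneVec_dotProduct_rankOneVec (u u' : m → ℝ) (w w' : n → ℝ) :
    rankOneVec u w ⬝ᵥ rankOneVec u' w' = (u ⬝ᵥ u') * (w ⬝ᵥ w') := by
  simp only [rankOneVec, dotProduct, Fintype.sum_prod_type, Finset.sum_mul_sum]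
  exact Finset.sum_congr rfl fun i _ => Finset.sum_congr rfl fun j _ => by ring

variable {I : Type*} [Fintype I]

/-- Comparison of a sum of two bilinear Gaussian forms with a sum of norms. -/
lemma integral_exp_sup_bilin_le [Nonempty I] {t : ℝ} (ht : 0 < t) {u₁ u₂ : I → m → ℝ}
    {w₁ w₂ : I → n → ℝ} (hu₁ : ∀ a, u₁ a ⬝ᵥ u₁ a = 1) (hu₂ : ∀ a, u₂ a ⬝ᵥ u₂ a = 1)
    (hw₁ : ∀ a, w₁ a ⬝ᵥ w₁ a = 1) (hw₂ : ∀ a, w₂ a ⬝ᵥ w₂ a = 1)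
    (hw : ∀ a b, w₁ a ⬝ᵥ w₂ b = 0) :
    ∫ ζ, Real.exp (t * Finset.univ.sup' Finset.univ_nonempty fun a =>
        (rankOneVec (u₁ a) (w₁ a) + rankOneVec (u₂ a) (w₂ a)) ⬝ᵥ ζ) ∂stdNormal (m × n) ≤
      Real.exp (t * (2 * (√(Fintype.card m) + √(Fintype.card n))) + t ^ 2) := by
  -- The processes use disjoint Gaussian coordinates, hence are independent. The auxiliary
  -- coordinate with weight `√2` raises the variance of `x` from 2 to 4, that of `y`. Writing `pᵢ`,
  -- `qᵢ` for the inner products of the `uᵢ` and of the `wᵢ`, the covariances differ by `(1 - p₁)(1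
  -- - q₁) + (1 - p₂)(1 - q₂) ≥ 0`; orthogonality of the `w₁` to the `w₂` removes the cross terms.
  set x : I → ((m × n) ⊕ Unit) ⊕ ((m ⊕ m) ⊕ (n ⊕ n)) → ℝ := fun a =>
    Sum.elim (Sum.elim (rankOneVec (u₁ a) (w₁ a) + rankOneVec (u₂ a) (w₂ a)) fun _ => √2) 0 with hx
  set y : I → ((m × n) ⊕ Unit) ⊕ ((m ⊕ m) ⊕ (n ⊕ n)) → ℝ := fun a =>
    Sum.elim 0 (Sum.elim (Sum.elim (u₁ a) (u₂ a)) (Sum.elim (w₁ a) (w₂ a))) with hy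
  have hw' (a b : I) : w₂ a ⬝ᵥ w₁ b = 0 := by rw [dotProduct_comm, hw]
  have hxx (a b : I) : x a ⬝ᵥ x b =
      (u₁ a ⬝ᵥ u₁ b) * (w₁ a ⬝ᵥ w₁ b) + (u₂ a ⬝ᵥ u₂ b) * (w₂ a ⬝ᵥ w₂ b) + 2 := by
    simp only [hx, sumElim_dotProduct, Sum.elim_comp_inl, Sum.elim_comp_inr, add_dotProduct, dotProduct_add,
      rankOneVec_dotProduct_rankOneVec, hw, hw', zero_dotProduct]
    simp [dotProduct]
  have hyy (a b : I) : y a ⬝ᵥ y b =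
      (u₁ a ⬝ᵥ u₁ b) + (u₂ a ⬝ᵥ u₂ b) + (w₁ a ⬝ᵥ w₁ b) + (w₂ a ⬝ᵥ w₂ b) := by
    simp only [hy, sumElim_dotProduct, Sum.elim_comp_inl, Sum.elim_comp_inr, zero_dotProduct]
    ring
  set R : (((m × n) ⊕ Unit) ⊕ ((m ⊕ m) ⊕ (n ⊕ n)) → ℝ) → ℝ := fun ζ =>
    √((ζ ∘ Sum.inr ∘ Sum.inl ∘ Sum.inl) ⬝ᵥ (ζ ∘ Sum.inr ∘ Sum.inl ∘ Sum.inl))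
      + √((ζ ∘ Sum.inr ∘ Sum.inl ∘ Sum.inr) ⬝ᵥ (ζ ∘ Sum.inr ∘ Sum.inl ∘ Sum.inr))
      + (√((ζ ∘ Sum.inr ∘ Sum.inr ∘ Sum.inl) ⬝ᵥ (ζ ∘ Sum.inr ∘ Sum.inr ∘ Sum.inl))
      + √((ζ ∘ Sum.inr ∘ Sum.inr ∘ Sum.inr) ⬝ᵥ (ζ ∘ Sum.inr ∘ Sum.inr ∘ Sum.inr))) with hR
  have hRint : Integrable (fun ζ => Real.exp (t * R ζ)) (stdNormal _) := by
    refine (ExpGrowth.exp_of_abs_le_linear (a := 0) (b := t * 4) ?_ (by positivity)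
      fun ζ => ?_).integrable
    · simp only [hR, dotProduct, Function.comp_apply]
      fun_prop
    · have i1 := sqrt_dotProduct_comp_le (j := Sum.inr ∘ Sum.inl ∘ Sum.inl)
        (Sum.inr_injective.comp (Sum.inl_injective.comp Sum.inl_injective)) ζ
      have i2 := sqrt_dotProduct_comp_le (j := Sum.inr ∘ Sum.inl ∘ Sum.inr)
        (Sum.inr_injective.comp (Sum.inl_injective.comp Sum.inr_injective)) ζ
      have i3 := sqrt_dotProduct_comp_le (j := Sum.inr ∘ Sum.inr ∘ Sum.inl)
        (Sum.inr_injective.comp (Sum.inr_injective.comp Sum.inl_injective)) ζ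
      have i4 := sqrt_dotProduct_comp_le (j := Sum.inr ∘ Sum.inr ∘ Sum.inr)
        (Sum.inr_injective.comp (Sum.inr_injective.comp Sum.inr_injective)) ζ
      rw [abs_of_nonneg (by positivity), zero_add, mul_assoc]
      gcongr
      simp only [hR]
      linarith
  have hcomp := integral_exp_sup_le (I := I) ht (x := x) (y := y) (R := R)
    (fun a b => by simp [hx, hy])
    (fun a => by rw [hxx, hyy, hu₁, hu₂, hw₁, hw₂]; norm_num)
    (fun a b => by
      rw [hxx, hyy]
      nlinarith [dotProduct_le_one (hu₁ a) (hu₁ b), dotProduct_le_one (hu₂ a) (hu₂ b),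
        dotProduct_le_one (hw₁ a) (hw₁ b), dotProduct_le_one (hw₂ a) (hw₂ b)])
    (fun a ζ => by
      simp only [hy, sumElim_dotProduct, zero_dotProduct, zero_add]
      exact add_le_add (add_le_add (dotProduct_le_sqrt (hu₁ a) _) (dotProduct_le_sqrt (hu₂ a) _))
        (add_le_add (dotProduct_le_sqrt (hw₁ a) _) (dotProduct_le_sqrt (hw₂ a) _)))
    hRint
  have hleft : ∫ ζ, Real.exp (t * Finset.univ.sup' Finset.univ_nonempty fun a => x a ⬝ᵥ ζ)
        ∂stdNormal (((m × n) ⊕ Unit) ⊕ ((m ⊕ m) ⊕ (n ⊕ n))) =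
      (∫ ζ, Real.exp (t * Finset.univ.sup' Finset.univ_nonempty fun a =>
        (rankOneVec (u₁ a) (w₁ a) + rankOneVec (u₂ a) (w₂ a)) ⬝ᵥ ζ) ∂stdNormal (m × n))
        * Real.exp (t ^ 2) := by
    have h1 : ∫ ζ : Unit → ℝ, Real.exp (t * √2 * ζ ()) ∂stdNormal Unit = Real.exp (t ^ 2) := by
      rw [stdNormal, integral_comp_eval (μ := fun _ : Unit => gaussianReal 0 1) (i := ())
        (f := fun z => Real.exp (t * √2 * z)) (by fun_prop)]
      have := congrFun (mgf_id_gaussianReal (μ := 0) (v := 1)) (t * √2)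
      rw [mgf] at this
      simp only [id] at this
      rw [this]
      congr 1
      rw [mul_pow, Real.sq_sqrt zero_le_two]
      simp
    rw [← h1, ← integral_stdNormal_sum]
    have h2 := integral_stdNormal_sum (ι := (m × n) ⊕ Unit) (κ := (m ⊕ m) ⊕ (n ⊕ n))
      (fun ζ => Real.exp (t * Finset.univ.sup' Finset.univ_nonempty fun a =>
        (rankOneVec (u₁ a) (w₁ a) + rankOneVec (u₂ a) (w₂ a)) ⬝ᵥ (ζ ∘ Sum.inl))
        * Real.exp (t * √2 * (ζ ∘ Sum.inr) ())) fun _ => 1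
    simp only [mul_one, integral_const, probReal_univ, smul_eq_mul] at h2
    rw [← h2]
    refine integral_congr_ae (Filter.Eventually.of_forall fun ζ => ?_)
    simp only
    rw [← Real.exp_add]
    congr 1
    have h3 : (fun a => x a ⬝ᵥ ζ) = fun a => ((rankOneVec (u₁ a) (w₁ a) +
        rankOneVec (u₂ a) (w₂ a)) ⬝ᵥ ((ζ ∘ Sum.inl) ∘ Sum.inl)) + √2 * ζ (Sum.inl (Sum.inr ())) := by
      funext a
      simp only [hx, sumElim_dotProduct, zero_dotProduct, add_zero]
      simp [dotProduct]
    rw [h3, ← Finset.sup'_add]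
    simp only [Function.comp_apply]
    ring
  have hright : ∫ ζ, Real.exp (t * R ζ) ∂stdNormal (((m × n) ⊕ Unit) ⊕ ((m ⊕ m) ⊕ (n ⊕ n))) =
      (∫ v : m → ℝ, Real.exp (t * √(v ⬝ᵥ v)) ∂stdNormal m) ^ 2 *
        (∫ v : n → ℝ, Real.exp (t * √(v ⬝ᵥ v)) ∂stdNormal n) ^ 2 := by
    rw [sq, sq, ← integral_stdNormal_sum, ← integral_stdNormal_sum, ← integral_stdNormal_sum]
    have h2 := integral_stdNormal_sum (ι := (m × n) ⊕ Unit) (κ := (m ⊕ m) ⊕ (n ⊕ n)) (fun _ => 1)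
      (fun x => (Real.exp (t * √(((x ∘ Sum.inl) ∘ Sum.inl) ⬝ᵥ ((x ∘ Sum.inl) ∘ Sum.inl))) *
        Real.exp (t * √(((x ∘ Sum.inl) ∘ Sum.inr) ⬝ᵥ ((x ∘ Sum.inl) ∘ Sum.inr)))) *
        (Real.exp (t * √(((x ∘ Sum.inr) ∘ Sum.inl) ⬝ᵥ ((x ∘ Sum.inr) ∘ Sum.inl))) *
        Real.exp (t * √(((x ∘ Sum.inr) ∘ Sum.inr) ⬝ᵥ ((x ∘ Sum.inr) ∘ Sum.inr)))))
    simp only [one_mul, integral_const, probReal_univ, smul_eq_mul] at h2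
    rw [← h2]
    refine integral_congr_ae (Filter.Eventually.of_forall fun ζ => ?_)
    simp only
    rw [← Real.exp_add, ← Real.exp_add, ← Real.exp_add]
    congr 1
    simp only [hR, Function.comp_assoc]
    ring
  have hm := integral_exp_norm_le (ι := m) ht.le
  have hn := integral_exp_norm_le (ι := n) ht.le
  rw [hleft, hright] at hcomp
  have hbound : (∫ v : m → ℝ, Real.exp (t * √(v ⬝ᵥ v)) ∂stdNormal m) ^ 2 *
        (∫ v : n → ℝ, Real.exp (t * √(v ⬝ᵥ v)) ∂stdNormal n) ^ 2 ≤
      Real.exp (t * √(Fintype.card m) + t ^ 2 / 2) ^ 2 *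
        Real.exp (t * √(Fintype.card n) + t ^ 2 / 2) ^ 2 := by
    gcongr
  -- The four norms contribute `exp (2 t²)` in all, of which the auxiliary coordinate cancels `exp
  -- (t²)`.
  refine le_of_mul_le_mul_right ((hcomp.trans hbound).trans (le_of_eq ?_)) (Real.exp_pos (t ^ 2))
  rw [← Real.exp_nat_mul, ← Real.exp_nat_mul, ← Real.exp_add, ← Real.exp_add]
  congr 1
  push_cast
  ring

/-- Chernoff's bound with parameter `t = s`, for which the exponent is `-2 s² + s²`. -/
lemma stdNormal_exists_lt_bilin_le {u₁ u₂ : I → m → ℝ}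
    {w₁ w₂ : I → n → ℝ} (hu₁ : ∀ a, u₁ a ⬝ᵥ u₁ a = 1) (hu₂ : ∀ a, u₂ a ⬝ᵥ u₂ a = 1)
    (hw₁ : ∀ a, w₁ a ⬝ᵥ w₁ a = 1) (hw₂ : ∀ a, w₂ a ⬝ᵥ w₂ a = 1)
    (hw : ∀ a b, w₁ a ⬝ᵥ w₂ b = 0) {s : ℝ} (hs : 0 < s) :
    stdNormal (m × n) {ζ | ∃ a, 2 * (√(Fintype.card m) + √(Fintype.card n) + s) <
        (rankOneVec (u₁ a) (w₁ a) + rankOneVec (u₂ a) (w₂ a)) ⬝ᵥ ζ} ≤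
      ENNReal.ofReal (Real.exp (-s ^ 2)) := by
  rcases isEmpty_or_nonempty I with hI | hI
  · simp
  set X : (m × n → ℝ) → ℝ := fun ζ => Finset.univ.sup' Finset.univ_nonempty fun a =>
    (rankOneVec (u₁ a) (w₁ a) + rankOneVec (u₂ a) (w₂ a)) ⬝ᵥ ζ with hX
  have hXc : Continuous X := by
    refine Continuous.finset_sup'_apply _ fun a _ => ?_
    unfold dotProduct; fun_prop
  have hint : Integrable (fun ζ => Real.exp (s * X ζ)) (stdNormal (m × n)) := by
    refine ((ExpGrowth.partitionFun s fun a =>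
      rankOneVec (u₁ a) (w₁ a) + rankOneVec (u₂ a) (w₂ a)).of_abs_le (by fun_prop)
      fun ζ => ?_).integrable
    rw [abs_of_pos (Real.exp_pos _), abs_of_pos (partitionFun_pos _ _ _)]
    obtain ⟨a, -, ha⟩ := Finset.exists_mem_eq_sup' (Finset.univ_nonempty (α := I))
      fun a => (rankOneVec (u₁ a) (w₁ a) + rankOneVec (u₂ a) (w₂ a)) ⬝ᵥ ζ
    simp only [hX, ha]
    exact exp_le_partitionFun s (fun a => rankOneVec (u₁ a) (w₁ a) + rankOneVec (u₂ a) (w₂ a)) ζ a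
  have hmarkov := measure_ge_le_exp_mul_mgf (μ := stdNormal (m × n)) (X := X)
    (2 * (√(Fintype.card m) + √(Fintype.card n) + s)) hs.le hint
  have hmgf : mgf X (stdNormal (m × n)) s ≤ _ :=
    integral_exp_sup_bilin_le hs hu₁ hu₂ hw₁ hw₂ hw
  refine (measure_mono (t := {ζ | 2 * (√(Fintype.card m) + √(Fintype.card n) + s) ≤ X ζ})
    fun ζ hζ => ?_).trans ?_
  · obtain ⟨a, ha⟩ := hζ
    exact ha.le.trans (Finset.le_sup' (fun a =>
      (rankOneVec (u₁ a) (w₁ a) + rankOneVec (u₂ a) (w₂ a)) ⬝ᵥ ζ) (Finset.mem_univ a))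
  · rw [← ofReal_measureReal]
    refine ENNReal.ofReal_le_ofReal (hmarkov.trans ?_)
    calc _ ≤ Real.exp (-s * (2 * (√(Fintype.card m) + √(Fintype.card n) + s))) *
          Real.exp (s * (2 * (√(Fintype.card m) + √(Fintype.card n))) + s ^ 2) := by gcongr
      _ = _ := by rw [← Real.exp_add]; congr 1; ring

lemma exists_unit_dotProduct_eq_sqrt [Nonempty m] (v : m → ℝ) :
    ∃ u : m → ℝ, u ⬝ᵥ u = 1 ∧ u ⬝ᵥ v = √(v ⬝ᵥ v) := by
  classical
  rcases eq_or_ne v 0 with rfl | hv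
  · obtain ⟨i⟩ := ‹Nonempty m›
    exact ⟨Pi.single i 1, by simp, by simp⟩
  · have hpos : 0 < v ⬝ᵥ v :=
      (dotProduct_self_nonneg_real v).lt_of_ne' fun h => hv (dotProduct_self_eq_zero.1 h)
    have hsq := Real.mul_self_sqrt hpos.le
    have hne : √(v ⬝ᵥ v) ≠ 0 := (Real.sqrt_pos.2 hpos).ne'
    refine ⟨(√(v ⬝ᵥ v))⁻¹ • v, ?_, ?_⟩ <;>
      simp only [smul_dotProduct, dotProduct_smul, smul_eq_mul]
    · rw [← mul_assoc, ← mul_inv, hsq, inv_mul_cancel₀ hpos.ne']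
    · rw [inv_mul_eq_iff_eq_mul₀ hne, hsq]

/-- With high probability, a standard Gaussian matrix satisfies
`‖G f‖ + ‖G g‖ ≤ 2 (√|m| + √|n| + s)` simultaneously for all unit vectors `f`, `g` from two
mutually orthogonal sets. -/
theorem stdNormal_exists_lt_norm_add_norm_le {S₁ S₂ : Set (n → ℝ)}
    (hS : ∀ f ∈ S₁, ∀ g ∈ S₂, f ⬝ᵥ g = 0) {s : ℝ} (hs : 0 < s) :
    stdNormal (m × n) {ζ | ∃ f ∈ S₁, ∃ g ∈ S₂, f ⬝ᵥ f = 1 ∧ g ⬝ᵥ g = 1 ∧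
        2 * (√(Fintype.card m) + √(Fintype.card n) + s) <
          √(((Matrix.of fun i j => ζ (i, j)) *ᵥ f) ⬝ᵥ ((Matrix.of fun i j => ζ (i, j)) *ᵥ f)) +
          √(((Matrix.of fun i j => ζ (i, j)) *ᵥ g) ⬝ᵥ ((Matrix.of fun i j => ζ (i, j)) *ᵥ g))} ≤
      ENNReal.ofReal (Real.exp (-s ^ 2)) := by
  rcases isEmpty_or_nonempty m with hm | hm
  · refine le_of_eq_of_le ?_ zero_le
    convert! measure_empty (μ := stdNormal (m × n))
    refine Set.eq_empty_of_forall_notMem fun ζ ⟨f, _, g, _, _, _, h⟩ => ?_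
    have h1 : 0 ≤ 2 * (√(Fintype.card m) + √(Fintype.card n) + s) := by positivity
    simp only [dotProduct, Finset.univ_eq_empty, Finset.sum_empty, Real.sqrt_zero, add_zero] at h
    linarith
  set c := 2 * (√(Fintype.card m) + √(Fintype.card n) + s) with hc
  set K : Set (((m → ℝ) × (m → ℝ)) × ((n → ℝ) × (n → ℝ))) :=
    {p | (p.1.1 ⬝ᵥ p.1.1 = 1 ∧ p.1.2 ⬝ᵥ p.1.2 = 1) ∧
      (p.2.1 ∈ S₁ ∧ p.2.2 ∈ S₂) ∧ p.2.1 ⬝ᵥ p.2.1 = 1 ∧ p.2.2 ⬝ᵥ p.2.2 = 1} with hK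
  set Φ : (m × n → ℝ) → K → ℝ := fun ζ p =>
    (rankOneVec p.1.1.1 p.1.2.1 + rankOneVec p.1.1.2 p.1.2.2) ⬝ᵥ ζ with hΦ
  have hΦc (ζ : m × n → ℝ) : Continuous (Φ ζ) := by
    simp only [hΦ, dotProduct, rankOneVec, Pi.add_apply]
    fun_prop
  rcases isEmpty_or_nonempty K with hKe | hKne
  · refine le_of_eq_of_le ?_ zero_le
    convert! measure_empty (μ := stdNormal (m × n))
    refine Set.eq_empty_of_forall_notMem fun ζ ⟨f, hf, g, hg, hf1, hg1, h⟩ => ?_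
    obtain ⟨u, hu, _⟩ := exists_unit_dotProduct_eq_sqrt (0 : m → ℝ)
    exact hKe.elim ⟨((u, u), (f, g)), ⟨hu, hu⟩, ⟨hf, hg⟩, hf1, hg1⟩
  -- Exceeding `c` is an open condition on the parameter, so a dense sequence detects it. Its
  -- initial segments give increasing events, and the finite bound does not depend on their length.
  set d := TopologicalSpace.denseSeq K with hd
  set B : ℕ → Set (m × n → ℝ) := fun k => {ζ | ∃ i : Fin k, c < Φ ζ (d i)} with hB
  have hmono : Monotone B := fun k l hkl ζ ⟨i, hi⟩ => ⟨Fin.castLE hkl i, hi⟩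
  refine (measure_mono (t := ⋃ k, B k) fun ζ hζ => ?_).trans ?_
  · obtain ⟨f, hf, g, hg, hf1, hg1, h⟩ := hζ
    obtain ⟨u, hu, hu'⟩ := exists_unit_dotProduct_eq_sqrt
      ((Matrix.of fun i j => ζ (i, j)) *ᵥ f : m → ℝ)
    obtain ⟨v, hv, hv'⟩ := exists_unit_dotProduct_eq_sqrt
      ((Matrix.of fun i j => ζ (i, j)) *ᵥ g : m → ℝ)
    have hopen : IsOpen {p : K | c < Φ ζ p} := isOpen_lt continuous_const (hΦc ζ)
    obtain ⟨p, hp, i, hi⟩ := (TopologicalSpace.denseRange_denseSeq K).inter_open_nonempty _ hopen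
      ⟨⟨((u, v), (f, g)), ⟨hu, hv⟩, ⟨hf, hg⟩, hf1, hg1⟩, by
        simp only [Set.mem_ofPred_eq, hΦ, add_dotProduct, rankOneVec_dotProduct, hu', hv']
        exact h⟩
    refine Set.mem_iUnion.2 ⟨i + 1, ⟨i, Nat.lt_succ_self i⟩, ?_⟩
    change c < Φ ζ (d i)
    rw [hd, hi]
    exact hp
  · rw [hmono.measure_iUnion]
    exact iSup_le fun k => stdNormal_exists_lt_bilin_le (I := Fin k)
      (fun i => (d i).2.1.1) (fun i => (d i).2.1.2) (fun i => (d i).2.2.2.1)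
      (fun i => (d i).2.2.2.2) (fun i j => hS _ (d i).2.2.1.1 _ (d j).2.2.1.2) hs

end GaussianMatrix

/-! ### Singular values and top right singular vectors -/

section SingularVectors

/-- One half of the Courant–Fischer principle. -/
lemma le_singularValues_of_forall_mem {E F : Type*} [NormedAddCommGroup E] [InnerProductSpace ℝ E]
    [FiniteDimensional ℝ E] [NormedAddCommGroup F] [InnerProductSpace ℝ F] [FiniteDimensional ℝ F]
    (T : E →ₗ[ℝ] F) (S : Submodule ℝ E) {j : ℕ} (hj : j < Module.finrank ℝ S) {c : ℝ}
    (hc : ∀ x ∈ S, c * ‖x‖ ≤ ‖T x‖) : c ≤ T.singularValues j := by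
  rcases le_or_gt c 0 with hc0 | hc0
  · exact hc0.trans (T.singularValues_nonneg j)
  have hn : j < Module.finrank ℝ E := hj.trans_le (Submodule.finrank_le S)
  set hsymm := T.isSymmetric_adjoint_comp_self
  set e := hsymm.eigenvectorBasis rfl with he
  -- Since `dim S > j`, some nonzero vector of `S` is orthogonal to the first `j` eigenvectors of
  -- `TᵀT`; `T` expands it by at most the singular value with (zero-based) index `j`.
  set L : S →ₗ[ℝ] (Fin j → ℝ) :=
    LinearMap.pi fun i => (innerₛₗ ℝ (e (Fin.castLE hn.le i))).comp S.subtype with hL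
  have hker : LinearMap.ker L ≠ ⊥ := LinearMap.ker_ne_bot_of_finrank_lt (by simpa using hj)
  obtain ⟨⟨x, hxS⟩, hxk, hx0⟩ := Submodule.exists_mem_ne_zero_of_ne_bot hker
  have hx0' : x ≠ 0 := fun h => hx0 (Subtype.ext h)
  have hcoef (i : Fin (Module.finrank ℝ E)) (hi : i.1 < j) : inner ℝ (e i) x = 0 :=
    congrFun (LinearMap.mem_ker.1 hxk) ⟨i.1, hi⟩
  have hTx : ‖T x‖ ^ 2 = ∑ i : Fin (Module.finrank ℝ E),
      T.singularValues i ^ 2 * inner ℝ (e i) x ^ 2 := by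
    rw [← real_inner_self_eq_norm_sq, ← LinearMap.adjoint_inner_right,
      ← e.sum_inner_mul_inner]
    refine Finset.sum_congr rfl fun i _ => ?_
    have h1 : inner ℝ (e i) ((LinearMap.adjoint T) (T x)) =
        T.singularValues i ^ 2 * inner ℝ (e i) x := by
      have h2 := hsymm (e i) x
      rw [he, hsymm.apply_eigenvectorBasis] at h2
      simp only [LinearMap.comp_apply] at h2
      rw [he, ← h2, T.sq_singularValues_fin rfl i]
      simp [inner_smul_left]
    rw [h1, real_inner_comm]
    ring
  have hle : ‖T x‖ ^ 2 ≤ T.singularValues j ^ 2 * ‖x‖ ^ 2 := by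
    rw [hTx, ← e.sum_sq_inner_right, Finset.mul_sum]
    refine Finset.sum_le_sum fun i _ => ?_
    rcases lt_or_ge i.1 j with hi | hi
    · rw [hcoef i hi]; simp
    · have h1 := T.singularValues_antitone hi
      have h2 := T.singularValues_nonneg i
      gcongr
  have hxpos : 0 < ‖x‖ := norm_pos_iff.2 hx0'
  have h1 : (c * ‖x‖) ^ 2 ≤ (T.singularValues j * ‖x‖) ^ 2 := by
    rw [mul_pow (T.singularValues j)]
    exact (pow_le_pow_left₀ (by positivity) (hc x hxS) 2).trans hle
  have h2 := le_of_sq_le_sq h1 (mul_nonneg (T.singularValues_nonneg j) hxpos.le)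
  exact le_of_mul_le_mul_right h2 hxpos

variable {m n : Type*} [Fintype m] [Fintype n] [DecidableEq n] {k : ℕ}

lemma norm_sq_toEuclideanLin (A : Matrix m n ℝ) (x : EuclideanSpace ℝ n) :
    ‖Matrix.toEuclideanLin A x‖ ^ 2 = (A *ᵥ x.ofLp) ⬝ᵥ (A *ᵥ x.ofLp) := by
  rw [EuclideanSpace.norm_sq_eq]
  simp [dotProduct, Matrix.toLpLin_apply, sq]

lemma norm_sq_toLp {n : Type*} [Fintype n] (x : n → ℝ) : ‖(WithLp.toLp 2 x : EuclideanSpace ℝ n)‖ ^ 2 = x ⬝ᵥ x := by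
  rw [EuclideanSpace.norm_sq_eq]
  simp [dotProduct, sq]

lemma singularValue_nonneg (A : Matrix m n ℝ) (l : ℕ) : 0 ≤ singularValue A l :=
  LinearMap.singularValues_nonneg _ _

lemma singularValue_le_of_le (A : Matrix m n ℝ) {i j : ℕ} (h : i ≤ j) :
    singularValue A j ≤ singularValue A i :=
  LinearMap.singularValues_antitone _ (Nat.sub_le_sub_right h 1)

lemma mulVec_dotProduct_mulVec_eq {m n : Type*} [Fintype m] [Fintype n] (A : Matrix m n ℝ) (x y : n → ℝ) :
    (A *ᵥ x) ⬝ᵥ (A *ᵥ y) = ((Aᵀ * A) *ᵥ x) ⬝ᵥ y := by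
  rw [← Matrix.mulVec_mulVec, Matrix.dotProduct_mulVec, Matrix.mulVec_transpose]

lemma mulVec_dotProduct_eq {m n : Type*} [Fintype m] [Fintype n] (A : Matrix m n ℝ) (x : n → ℝ)
    (y : m → ℝ) : (A *ᵥ x) ⬝ᵥ y = x ⬝ᵥ (Aᵀ *ᵥ y) := by
  rw [Matrix.dotProduct_mulVec, Matrix.vecMul_transpose]

lemma mulVec_dotProduct_mulVec_self {n l : Type*} [Fintype n] [Fintype l] [DecidableEq l] {V : Matrix n l ℝ}
    (hV : Vᵀ * V = 1) (x y : l → ℝ) : (V *ᵥ x) ⬝ᵥ (V *ᵥ y) = x ⬝ᵥ y := by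
  rw [mulVec_dotProduct_eq, Matrix.mulVec_mulVec, hV, Matrix.one_mulVec]

namespace IsTopRightSingularVectors

variable {B : Matrix m n ℝ} {W : Matrix n (Fin k) ℝ}

lemma mulVec_dotProduct (hW : IsTopRightSingularVectors B W) (y : Fin k → ℝ) (x : n → ℝ) :
    (B *ᵥ (W *ᵥ y)) ⬝ᵥ (B *ᵥ x) =
      ∑ j, singularValue B (j.1 + 1) ^ 2 * y j * (Wᵀ *ᵥ x) j := by
  rw [mulVec_dotProduct_mulVec_eq, Matrix.mulVec_mulVec, hW.2, ← Matrix.mulVec_mulVec,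
    mulVec_dotProduct_eq]
  simp [dotProduct, Matrix.mulVec_diagonal]

lemma norm_sq_mulVec (hW : IsTopRightSingularVectors B W) (y : Fin k → ℝ) :
    (B *ᵥ (W *ᵥ y)) ⬝ᵥ (B *ᵥ (W *ᵥ y)) = ∑ j, singularValue B (j.1 + 1) ^ 2 * (y j * y j) := by
  rw [hW.mulVec_dotProduct, Matrix.mulVec_mulVec, hW.1, Matrix.one_mulVec]
  exact Finset.sum_congr rfl fun j _ => by ring

lemma dotProduct_eq_zero (hW : IsTopRightSingularVectors B W) (y : Fin k → ℝ) {x : n → ℝ}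
    (hx : Wᵀ *ᵥ x = 0) : (B *ᵥ (W *ᵥ y)) ⬝ᵥ (B *ᵥ x) = 0 := by
  rw [hW.mulVec_dotProduct, hx]
  simp

lemma le_norm_sq_mulVec (hW : IsTopRightSingularVectors B W) (y : Fin k → ℝ) :
    singularValue B k ^ 2 * (y ⬝ᵥ y) ≤ (B *ᵥ (W *ᵥ y)) ⬝ᵥ (B *ᵥ (W *ᵥ y)) := by
  rw [hW.norm_sq_mulVec, dotProduct, Finset.mul_sum]
  refine Finset.sum_le_sum fun j _ => ?_
  have h1 := singularValue_le_of_le B (Nat.succ_le_of_lt j.2)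
  have h2 := singularValue_nonneg B k
  have h3 := mul_self_nonneg (y j)
  gcongr

lemma castLE (hW : IsTopRightSingularVectors B W) {j : ℕ} (hj : j ≤ k) :
    IsTopRightSingularVectors B (W.submatrix id (Fin.castLE hj)) := by
  constructor
  · ext a b
    have := congrFun (congrFun hW.1 (Fin.castLE hj a)) (Fin.castLE hj b)
    simp only [Matrix.mul_apply, Matrix.transpose_apply, Matrix.submatrix_apply, id,
      Matrix.one_apply, (Fin.castLE_injective hj).eq_iff] at this ⊢
    exact this
  · ext a b
    have := congrFun (congrFun hW.2 a) (Fin.castLE hj b)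
    rw [Matrix.mul_diagonal] at this ⊢
    simpa [Matrix.mul_apply] using this

/-- A vector orthogonal to the top `k` singular vectors bounds the next singular value. -/
lemma le_singularValue_succ (hW : IsTopRightSingularVectors B W) {b : n → ℝ} (hb0 : b ≠ 0)
    (hb : Wᵀ *ᵥ b = 0) {c : ℝ} (hc : 0 ≤ c) (hBb : c ^ 2 * (b ⬝ᵥ b) ≤ (B *ᵥ b) ⬝ᵥ (B *ᵥ b))
    (hck : ∀ j : Fin k, c ≤ singularValue B (j.1 + 1)) : c ≤ singularValue B (k + 1) := by
  -- The range of `L` is the column span of `W` plus the line through `b`, of dimension `k + 1`. The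
  -- two summands, and also their images under `B`, are orthogonal, so `B` expands by at least `c`
  -- on all of it.
  set L : (Fin k → ℝ) × ℝ →ₗ[ℝ] EuclideanSpace ℝ n :=
    (WithLp.linearEquiv 2 ℝ (n → ℝ)).symm.toLinearMap.comp
      (W.mulVecLin.coprod (LinearMap.toSpanSingleton ℝ (n → ℝ) b)) with hL
  have hLp (p : (Fin k → ℝ) × ℝ) : L p = WithLp.toLp 2 (W *ᵥ p.1 + p.2 • b) := by
    simp [hL]
  have hWb (y : Fin k → ℝ) : (W *ᵥ y) ⬝ᵥ b = 0 := by
    rw [mulVec_dotProduct_eq, hb, dotProduct_zero]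
  have hnorm (p : (Fin k → ℝ) × ℝ) : ‖L p‖ ^ 2 = p.1 ⬝ᵥ p.1 + p.2 ^ 2 * (b ⬝ᵥ b) := by
    rw [hLp, norm_sq_toLp]
    simp only [add_dotProduct, dotProduct_add, smul_dotProduct, dotProduct_smul, smul_eq_mul,
      hWb, dotProduct_comm b, mulVec_dotProduct_mulVec_self hW.1]
    ring
  have hbpos : 0 < b ⬝ᵥ b :=
    (dotProduct_self_nonneg_real b).lt_of_ne' fun h => hb0 (dotProduct_self_eq_zero.1 h)
  have hinj : Function.Injective L := by
    rw [← LinearMap.ker_eq_bot, LinearMap.ker_eq_bot']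
    intro p hp
    have h := hnorm p
    rw [hp, norm_zero] at h
    have h1 := dotProduct_self_nonneg_real p.1
    have h2 := mul_nonneg (sq_nonneg p.2) hbpos.le
    have h3 : p.1 ⬝ᵥ p.1 = 0 := by linarith
    have h4 : p.2 ^ 2 * (b ⬝ᵥ b) = 0 := by linarith
    refine Prod.ext (dotProduct_self_eq_zero.1 h3) ?_
    simpa [hbpos.ne'] using h4
  refine le_singularValues_of_forall_mem (Matrix.toEuclideanLin B) (LinearMap.range L) ?_ ?_
  · rw [LinearMap.finrank_range_of_inj hinj]
    simp
  · rintro _ ⟨p, rfl⟩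
    refine le_of_sq_le_sq ?_ (norm_nonneg _)
    rw [mul_pow, hnorm, norm_sq_toEuclideanLin, hLp]
    simp only [Matrix.mulVec_add, Matrix.mulVec_smul, add_dotProduct, dotProduct_add,
      smul_dotProduct, dotProduct_smul, smul_eq_mul, dotProduct_comm (B *ᵥ b) (B *ᵥ (W *ᵥ p.1)),
      hW.dotProduct_eq_zero p.1 hb]
    have h1 : c ^ 2 * (p.1 ⬝ᵥ p.1) ≤ (B *ᵥ (W *ᵥ p.1)) ⬝ᵥ (B *ᵥ (W *ᵥ p.1)) := by
      rw [hW.norm_sq_mulVec, dotProduct, Finset.mul_sum]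
      refine Finset.sum_le_sum fun j _ => ?_
      have h3 := mul_self_nonneg (p.1 j)
      have h4 := hck j
      gcongr
    nlinarith [sq_nonneg p.2, mul_le_mul_of_nonneg_left hBb (sq_nonneg p.2)]

/-- The quadratic form of `BᵀB` on the orthogonal complement of the top `k` singular vectors is
at most the square of the `k`-th singular value. -/
lemma norm_sq_mulVec_le_of_orthogonal (hW : IsTopRightSingularVectors B W) (hk : 0 < k)
    {b : n → ℝ} (hb : Wᵀ *ᵥ b = 0) :
    (B *ᵥ b) ⬝ᵥ (B *ᵥ b) ≤ singularValue B k ^ 2 * (b ⬝ᵥ b) := by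
  rcases eq_or_ne b 0 with rfl | hb0
  · simp
  by_contra! hcon
  have hbpos : 0 < b ⬝ᵥ b :=
    (dotProduct_self_nonneg_real b).lt_of_ne' fun h => hb0 (dotProduct_self_eq_zero.1 h)
  set c := √((B *ᵥ b) ⬝ᵥ (B *ᵥ b) / (b ⬝ᵥ b)) with hc
  have hcsq : c ^ 2 * (b ⬝ᵥ b) = (B *ᵥ b) ⬝ᵥ (B *ᵥ b) := by
    rw [hc, Real.sq_sqrt (div_nonneg (dotProduct_self_nonneg_real _) hbpos.le),
      div_mul_cancel₀ _ hbpos.ne']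
  have hc0 : 0 ≤ c := Real.sqrt_nonneg _
  have hlt : singularValue B k < c := by
    rw [← hcsq] at hcon
    exact lt_of_pow_lt_pow_left₀ 2 hc0 (lt_of_mul_lt_mul_right hcon hbpos.le)
  have hex : ∃ j, singularValue B (j + 1) < c := ⟨k - 1, by rwa [Nat.sub_add_cancel hk]⟩
  classical
  -- The first index whose singular value drops below `c`. The top `j` vectors then all have
  -- singular value at least `c`, and adding `b` would make the next one at least `c` as well.
  set j := Nat.find hex with hj
  have hjk : j ≤ k := (Nat.find_min' hex (by rwa [Nat.sub_add_cancel hk])).trans (Nat.sub_le k 1)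
  have hjlt : singularValue B (j + 1) < c := Nat.find_spec hex
  refine absurd ((hW.castLE hjk).le_singularValue_succ hb0 ?_ hc0 hcsq.le fun i => ?_)
    (not_le.2 hjlt)
  · funext i
    exact congrFun hb (Fin.castLE hjk i)
  · exact not_lt.1 (Nat.find_min hex i.2)

/-- The `k`-th singular value separates the Rayleigh quotients on the span of `W` from those on its
complement. This ordering, with no gap, is what the angle bound uses about `W`. -/
lemma norm_sq_mul_le (hW : IsTopRightSingularVectors B W) (y : Fin k → ℝ) {b : n → ℝ}
    (hb : Wᵀ *ᵥ b = 0) :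
    ((B *ᵥ b) ⬝ᵥ (B *ᵥ b)) * (y ⬝ᵥ y) ≤
      ((B *ᵥ (W *ᵥ y)) ⬝ᵥ (B *ᵥ (W *ᵥ y))) * (b ⬝ᵥ b) := by
  rcases Nat.eq_zero_or_pos k with rfl | hk
  · simp [dotProduct]
  calc _ ≤ (singularValue B k ^ 2 * (b ⬝ᵥ b)) * (y ⬝ᵥ y) :=
        mul_le_mul_of_nonneg_right (hW.norm_sq_mulVec_le_of_orthogonal hk hb)
          (dotProduct_self_nonneg_real y)
    _ = (singularValue B k ^ 2 * (y ⬝ᵥ y)) * (b ⬝ᵥ b) := by ring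
    _ ≤ _ := mul_le_mul_of_nonneg_right (hW.le_norm_sq_mulVec y) (dotProduct_self_nonneg_real b)

end IsTopRightSingularVectors

lemma finrank_range_toEuclideanLin (A : Matrix m n ℝ) :
    Module.finrank ℝ (LinearMap.range (Matrix.toEuclideanLin A)) = A.rank := by
  rw [Matrix.rank_eq_finrank_range_toLin A (EuclideanSpace.basisFun m ℝ).toBasis
    (EuclideanSpace.basisFun n ℝ).toBasis, Matrix.toEuclideanLin_eq_toLin_orthonormal]

lemma singularValue_rank_pos (A : Matrix m n ℝ) (h : 0 < A.rank) : 0 < singularValue A A.rank := by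
  refine (LinearMap.singularValues_pos_iff_lt_finrank_range _).2 ?_
  rw [finrank_range_toEuclideanLin]
  omega

/-- The right singular vectors for the nonzero singular values span the row space. -/
lemma IsTopRightSingularVectors.mulVec_eq_zero {A : Matrix m n ℝ} {V : Matrix n (Fin A.rank) ℝ}
    (hV : IsTopRightSingularVectors A V) {b : n → ℝ} (hb : Vᵀ *ᵥ b = 0) : A *ᵥ b = 0 := by
  by_contra hAb
  have hb0 : b ≠ 0 := by rintro rfl; simp at hAb
  have hbpos : 0 < b ⬝ᵥ b :=
    (dotProduct_self_nonneg_real b).lt_of_ne' fun h => hb0 (dotProduct_self_eq_zero.1 h)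
  have hApos : 0 < (A *ᵥ b) ⬝ᵥ (A *ᵥ b) :=
    (dotProduct_self_nonneg_real _).lt_of_ne' fun h => hAb (dotProduct_self_eq_zero.1 h)
  set c := √((A *ᵥ b) ⬝ᵥ (A *ᵥ b) / (b ⬝ᵥ b)) with hc
  have hcsq : c ^ 2 * (b ⬝ᵥ b) = (A *ᵥ b) ⬝ᵥ (A *ᵥ b) := by
    rw [hc, Real.sq_sqrt (div_nonneg hApos.le hbpos.le), div_mul_cancel₀ _ hbpos.ne']
  have hcpos : 0 < c := Real.sqrt_pos.2 (div_pos hApos hbpos)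
  -- Counted from one, index `rank + 1` is the first vanishing singular value; a vector `b`
  -- orthogonal to `V` with `A b ≠ 0` would make it positive.
  have hlast : singularValue A (A.rank + 1) = 0 := by
    change (Matrix.toEuclideanLin A).singularValues A.rank = 0
    rw [← finrank_range_toEuclideanLin]
    exact LinearMap.singularValues_finrank_range_self _
  rcases Nat.eq_zero_or_pos A.rank with h0 | h0
  · have := hV.le_singularValue_succ hb0 hb hcpos.le hcsq.le fun j => absurd j.2 (by omega)
    linarith
  · have hs := singularValue_rank_pos A h0
    have hmin : 0 < min c (singularValue A A.rank) := lt_min hcpos hs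
    have := hV.le_singularValue_succ hb0 hb hmin.le
      (le_trans (mul_le_mul_of_nonneg_right
        (pow_le_pow_left₀ hmin.le (min_le_left _ _) 2) hbpos.le) hcsq.le)
      fun j => (min_le_right _ _).trans (singularValue_le_of_le A (Nat.succ_le_of_lt j.2))
    linarith

end SingularVectors

/-! ### Perturbation of right singular subspaces -/

section Perturbation

lemma sqrt_dotProduct_add_le {ι : Type*} [Fintype ι] (x y : ι → ℝ) :
    √((x + y) ⬝ᵥ (x + y)) ≤ √(x ⬝ᵥ x) + √(y ⬝ᵥ y) := by
  refine Real.sqrt_le_iff.2 ⟨by positivity, ?_⟩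
  have h := dotProduct_le_sqrt_mul_sqrt x y
  have hx := Real.sq_sqrt (dotProduct_self_nonneg_real x)
  have hy := Real.sq_sqrt (dotProduct_self_nonneg_real y)
  simp only [add_dotProduct, dotProduct_add, dotProduct_comm y x]
  nlinarith

variable {m n : Type*} [Fintype m] [Fintype n] {k : ℕ}

/-- `‖E f‖ + ‖E g‖ ≤ c` for all unit vectors `f` in the column span of `V` and `g` orthogonal
to it. -/
def SplitNormBound (E : Matrix m n ℝ) (V : Matrix n (Fin k) ℝ) (c : ℝ) : Prop :=
  ∀ f g : n → ℝ, (∃ z, f = V *ᵥ z) → Vᵀ *ᵥ g = 0 → f ⬝ᵥ f = 1 → g ⬝ᵥ g = 1 →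
    √((E *ᵥ f) ⬝ᵥ (E *ᵥ f)) + √((E *ᵥ g) ⬝ᵥ (E *ᵥ g)) ≤ c

/-- The budget `c` is shared: noise of size `e = ‖E f‖` is spent on lowering `‖B f‖` below `‖A f‖`,
and at most `c - e` remains for `‖B g‖ = ‖E g‖`, as `A g = 0`. -/
lemma SplitNormBound.sqrt_le {A B : Matrix m n ℝ} {V : Matrix n (Fin k) ℝ} {c s : ℝ}
    (hE : SplitNormBound (B - A) V c) (hA0 : ∀ b, Vᵀ *ᵥ b = 0 → A *ᵥ b = 0)
    {f g : n → ℝ} (hf : ∃ z, f = V *ᵥ z) (hg : Vᵀ *ᵥ g = 0) (hf1 : f ⬝ᵥ f = 1)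
    (hg1 : g ⬝ᵥ g = 1) (hs : s ≤ √((A *ᵥ f) ⬝ᵥ (A *ᵥ f))) :
    ∃ e, 0 ≤ e ∧ s - e ≤ √((B *ᵥ f) ⬝ᵥ (B *ᵥ f)) ∧ e + √((B *ᵥ g) ⬝ᵥ (B *ᵥ g)) ≤ c := by
  refine ⟨√(((B - A) *ᵥ f) ⬝ᵥ ((B - A) *ᵥ f)), Real.sqrt_nonneg _, ?_, ?_⟩
  · have h1 : A *ᵥ f = B *ᵥ f + -((B - A) *ᵥ f) := by
      rw [Matrix.sub_mulVec]; abel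
    have h2 := sqrt_dotProduct_add_le (B *ᵥ f) (-((B - A) *ᵥ f))
    rw [← h1, neg_dotProduct_neg] at h2
    linarith
  · have h1 : B *ᵥ g = (B - A) *ᵥ g := by rw [Matrix.sub_mulVec, hA0 g hg, sub_zero]
    rw [h1]
    exact hE f g hf hg hf1 hg1

/-- The scalar inequality behind the bound for a principal angle with squared sine `l`: here `X`
and `Y` are the energies of the two components of a vector of the first subspace. -/
lemma sin_sq_le_of_quadratic_forms {l X Y G e s c : ℝ} (hl0 : 0 < l) (hl1 : 0 < 1 - l)
    (hs : 0 < s) (hcs : c < s) (hX0 : 0 ≤ X) (hY0 : 0 ≤ Y) (hXY : Y * (1 - l) ≤ X * l)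
    (hBg : (l * (1 - l)) * G = (1 - l) ^ 2 * Y + l ^ 2 * X) (he0 : 0 ≤ e)
    (h1 : s - e ≤ √(X + Y)) (h2 : e + √G ≤ c) : l ≤ (c / s) ^ 2 := by
  have hμ : 0 < l * (1 - l) := mul_pos hl0 hl1
  have hG0 : 0 ≤ G := by
    refine le_of_mul_le_mul_left ?_ hμ
    rw [hBg, mul_zero]
    positivity
  rcases lt_or_ge (1 / 2) l with hhalf | hhalf
  -- For `l > 1/2` the ordering `hXY` gives `X + Y ≤ G`, hence `s - e ≤ c - e`, against `c < s`.
  · exfalso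
    have hle : X + Y ≤ G := by
      refine le_of_mul_le_mul_left ?_ hμ
      rw [hBg]
      nlinarith [mul_le_mul_of_nonneg_right hXY (show 0 ≤ l - (1 - l) by linarith)]
    linarith [Real.sqrt_le_sqrt hle]
  -- For `l ≤ 1/2` this yields `√l (s - e) ≤ c - e`; since `√l e ≤ e`, also `√l s ≤ c`.
  · have hle : l * (X + Y) ≤ G := by
      have h3 : l * (l * (X + Y)) ≤ l * ((1 - l) * G) := by
        rw [← mul_assoc l (1 - l), hBg]
        nlinarith [mul_nonneg (show 0 ≤ (1 - l) ^ 2 - l ^ 2 by nlinarith) hY0]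
      have h4 := le_of_mul_le_mul_left h3 hl0
      exact h4.trans (mul_le_of_le_one_left hG0 (by linarith))
    have h5 : √l * √(X + Y) ≤ √G := by
      rw [← Real.sqrt_mul hl0.le]; exact Real.sqrt_le_sqrt hle
    have h6 : √l ≤ 1 := Real.sqrt_le_one.2 (by linarith)
    have h7 : √l * (s - e) ≤ √l * √(X + Y) := mul_le_mul_of_nonneg_left h1 (Real.sqrt_nonneg l)
    have h8 : √l * s ≤ c := by
      have : √l * e ≤ e := mul_le_of_le_one_left he0 h6
      linarith
    have h9 : √l ≤ c / s := (le_div_iff₀ hs).2 h8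
    calc l = √l ^ 2 := (Real.sq_sqrt hl0.le).symm
      _ ≤ _ := pow_le_pow_left₀ (Real.sqrt_nonneg l) h9 2

/-- A lower bound on all singular values passes to the transpose of a square matrix. -/
lemma le_norm_sq_transpose_mulVec {κ : Type*} [Fintype κ] [DecidableEq κ] {C : Matrix κ κ ℝ}
    {c : ℝ} (h : ∀ z, c * (z ⬝ᵥ z) ≤ (C *ᵥ z) ⬝ᵥ (C *ᵥ z)) (z : κ → ℝ) :
    c * (z ⬝ᵥ z) ≤ (Cᵀ *ᵥ z) ⬝ᵥ (Cᵀ *ᵥ z) := by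
  rcases le_or_gt c 0 with hc | hc
  · exact (mul_nonpos_of_nonpos_of_nonneg hc (dotProduct_self_nonneg_real z)).trans
      (dotProduct_self_nonneg_real _)
  have hinj : Function.Injective C.mulVecLin := by
    rw [← LinearMap.ker_eq_bot, LinearMap.ker_eq_bot']
    intro y hy
    have h1 := h y
    rw [Matrix.mulVecLin_apply] at hy
    rw [hy, dotProduct_zero] at h1
    have h2 := dotProduct_self_nonneg_real y
    exact dotProduct_self_eq_zero.1 (le_antisymm (by nlinarith) h2)
  -- For `c > 0` the square matrix is invertible, so `z = C y`. Cauchy–Schwarz gives `‖C y‖⁴ ≤ ‖y‖²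
  -- ‖Cᵀ C y‖²`, and `c ‖y‖² ≤ ‖C y‖²` finishes.
  obtain ⟨y, rfl⟩ := (LinearMap.injective_iff_surjective.1 hinj) z
  rw [Matrix.mulVecLin_apply]
  have h1 := h y
  set p := (C *ᵥ y) ⬝ᵥ (C *ᵥ y) with hp
  have h2 : p = y ⬝ᵥ (Cᵀ *ᵥ (C *ᵥ y)) := by rw [hp, mulVec_dotProduct_eq]
  have h3 := dotProduct_le_sqrt_mul_sqrt y (Cᵀ *ᵥ (C *ᵥ y))
  rw [← h2] at h3
  set q := (Cᵀ *ᵥ (C *ᵥ y)) ⬝ᵥ (Cᵀ *ᵥ (C *ᵥ y)) with hq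
  have hp0 : 0 ≤ p := dotProduct_self_nonneg_real _
  have hq0 : 0 ≤ q := dotProduct_self_nonneg_real _
  have hy0 := dotProduct_self_nonneg_real y
  have h4 : p ^ 2 ≤ (y ⬝ᵥ y) * q := by
    rw [← Real.sq_sqrt hy0, ← Real.sq_sqrt hq0, ← mul_pow]
    exact pow_le_pow_left₀ hp0 h3 2
  rcases hp0.eq_or_lt with h0 | h0
  · rw [← h0, mul_zero]; exact hq0
  · refine le_of_mul_le_mul_right ?_ h0
    nlinarith [mul_le_mul_of_nonneg_right h1 hq0, mul_le_mul_of_nonneg_left h4 hc.le]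

/-- All singular values of `WᵀV` are at least `√(1 - a²)`. -/
def CosineBound (V W : Matrix n (Fin k) ℝ) (a : ℝ) : Prop :=
  ∀ z, (1 - a ^ 2) * (z ⬝ᵥ z) ≤ (Wᵀ *ᵥ (V *ᵥ z)) ⬝ᵥ (Wᵀ *ᵥ (V *ᵥ z))

/-- Both frames have `k` columns, so `WᵀV` is square and shares its singular values with its
transpose. -/
lemma CosineBound.symm {V W : Matrix n (Fin k) ℝ} {a : ℝ} (h : CosineBound V W a) :
    CosineBound W V a := fun z => by
  have h1 := le_norm_sq_transpose_mulVec (C := Wᵀ * V) (c := 1 - a ^ 2)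
    (fun z => by rw [← Matrix.mulVec_mulVec]; exact h z) z
  rwa [Matrix.transpose_mul, Matrix.transpose_transpose, ← Matrix.mulVec_mulVec] at h1

variable [DecidableEq n]

/-- Bound for a squared sine of a principal angle. -/
lemma sin_sq_le_of_eigenvector {A B : Matrix m n ℝ} {V W : Matrix n (Fin k) ℝ}
    (hV : Vᵀ * V = 1) (hW : IsTopRightSingularVectors B W) {s c : ℝ} (hs : 0 < s) (hcs : c < s)
    (hAV : ∀ z, s ^ 2 * (z ⬝ᵥ z) ≤ (A *ᵥ (V *ᵥ z)) ⬝ᵥ (A *ᵥ (V *ᵥ z)))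
    (hA0 : ∀ b, Vᵀ *ᵥ b = 0 → A *ᵥ b = 0) (hE : SplitNormBound (B - A) V c)
    {z : Fin k → ℝ} (hz : z ⬝ᵥ z = 1) {l : ℝ}
    (hl : z - (Vᵀ *ᵥ (W *ᵥ (Wᵀ *ᵥ (V *ᵥ z)))) = l • z) : l ≤ (c / s) ^ 2 := by
  set f := V *ᵥ z with hf
  set y := Wᵀ *ᵥ f with hy
  set a := W *ᵥ y with ha
  -- `f` splits into its projection `a` on the span of `W` and the residual `b`; `hl` makes `l =
  -- ‖b‖²` the squared sine of a principal angle.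
  set b := f - a with hb
  have hf1 : f ⬝ᵥ f = 1 := by rw [hf, mulVec_dotProduct_mulVec_self hV, hz]
  have hVf : Vᵀ *ᵥ f = z := by rw [hf, Matrix.mulVec_mulVec, hV, Matrix.one_mulVec]
  have hWa : Wᵀ *ᵥ a = y := by rw [ha, Matrix.mulVec_mulVec, hW.1, Matrix.one_mulVec]
  have hWb : Wᵀ *ᵥ b = 0 := by rw [hb, Matrix.mulVec_sub, hWa, sub_self]
  have hVb : Vᵀ *ᵥ b = l • z := by rw [hb, Matrix.mulVec_sub, hVf, hl]
  have hVa : Vᵀ *ᵥ a = (1 - l) • z := by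
    rw [sub_smul, one_smul, ← hl]; abel
  have haa : a ⬝ᵥ a = y ⬝ᵥ y := by rw [ha, mulVec_dotProduct_mulVec_self hW.1]
  have hab : a ⬝ᵥ b = 0 := by rw [ha, mulVec_dotProduct_eq, hWb, dotProduct_zero]
  have hfab : f = a + b := by rw [hb]; abel
  have hfb : f ⬝ᵥ b = l := by
    rw [hf, mulVec_dotProduct_eq, hVb, dotProduct_smul, hz, smul_eq_mul, mul_one]
  have hbb : b ⬝ᵥ b = l := by
    rw [← hfb, hfab, add_dotProduct, hab, zero_add]
  have hyy : y ⬝ᵥ y = 1 - l := by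
    have : f ⬝ᵥ f = a ⬝ᵥ a + b ⬝ᵥ b := by
      rw [hfab, add_dotProduct, dotProduct_add, dotProduct_add, dotProduct_comm b a, hab]; ring
    linarith
  have hl0 : 0 ≤ l := hbb ▸ dotProduct_self_nonneg_real b
  have hl1 : 0 ≤ 1 - l := hyy ▸ dotProduct_self_nonneg_real y
  have hAf : s ≤ √((A *ᵥ f) ⬝ᵥ (A *ᵥ f)) := by
    refine Real.le_sqrt_of_sq_le ?_
    have := hAV z
    rwa [hz, mul_one] at this
  rcases hl0.eq_or_lt with hl0 | hl0
  · rw [← hl0]; positivity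
  rcases hl1.eq_or_lt with hl1 | hl1
  -- If `l = 1` then `f` is orthogonal to the span of `W` and `WᵀV` is singular. So is its
  -- transpose, which gives a unit vector `g` in the span of `W` orthogonal to `V`. The ordering
  -- says `‖B f‖ ≤ ‖B g‖`, which contradicts `c < s`.
  · exfalso
    have hy0 : y = 0 := dotProduct_self_eq_zero.1 (by rw [hyy, ← hl1])
    have hz0 : z ≠ 0 := by rintro rfl; simp at hz
    have hdet : (Wᵀ * V).det = 0 :=
      Matrix.exists_mulVec_eq_zero_iff.1 ⟨z, hz0, by rw [← Matrix.mulVec_mulVec]; exact hy0⟩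
    have hdet' : (Vᵀ * W).det = 0 := by
      rw [← Matrix.det_transpose, Matrix.transpose_mul, Matrix.transpose_transpose, hdet]
    obtain ⟨y', hy', hVW⟩ := Matrix.exists_mulVec_eq_zero_iff.2 hdet'
    have hy'pos : 0 < y' ⬝ᵥ y' :=
      (dotProduct_self_nonneg_real y').lt_of_ne' fun h => hy' (dotProduct_self_eq_zero.1 h)
    set w := (√(y' ⬝ᵥ y'))⁻¹ • y' with hw
    have hww : w ⬝ᵥ w = 1 := by
      rw [hw]
      simp only [smul_dotProduct, dotProduct_smul, smul_eq_mul]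
      rw [← mul_assoc, ← mul_inv, Real.mul_self_sqrt hy'pos.le, inv_mul_cancel₀ hy'pos.ne']
    have hVg : Vᵀ *ᵥ (W *ᵥ w) = 0 := by
      rw [Matrix.mulVec_mulVec, hw, Matrix.mulVec_smul, hVW, smul_zero]
    have hg1 : (W *ᵥ w) ⬝ᵥ (W *ᵥ w) = 1 := by rw [mulVec_dotProduct_mulVec_self hW.1, hww]
    obtain ⟨e, _, h1, h2⟩ := hE.sqrt_le hA0 ⟨z, hf⟩ hVg hf1 hg1 hAf
    have h3 := hW.norm_sq_mul_le w (b := f) hy0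
    rw [hww, hf1, mul_one, mul_one] at h3
    linarith [Real.sqrt_le_sqrt h3]
  set X := (B *ᵥ a) ⬝ᵥ (B *ᵥ a) with hX
  set Y := (B *ᵥ b) ⬝ᵥ (B *ᵥ b) with hY
  have hXY : Y * (1 - l) ≤ X * l := by
    have := hW.norm_sq_mul_le y hWb
    rwa [hyy, hbb] at this
  have horth : (B *ᵥ a) ⬝ᵥ (B *ᵥ b) = 0 := hW.dotProduct_eq_zero y hWb
  have hX0 : 0 ≤ X := dotProduct_self_nonneg_real _
  have hY0 : 0 ≤ Y := dotProduct_self_nonneg_real _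
  have hμ : 0 < l * (1 - l) := mul_pos hl0 hl1
  -- The unit vector in the plane of `a` and `b` that is orthogonal to `V`: the coefficients cancel
  -- `Vᵀ a = (1 - l) z` against `Vᵀ b = l z`.
  set g := (√(l * (1 - l)))⁻¹ • ((1 - l) • b - l • a) with hg
  have hμinv : (√(l * (1 - l)))⁻¹ * (√(l * (1 - l)))⁻¹ * (l * (1 - l)) = 1 := by
    rw [← mul_inv, Real.mul_self_sqrt hμ.le, inv_mul_cancel₀ hμ.ne']
  have hVg : Vᵀ *ᵥ g = 0 := by
    rw [hg, Matrix.mulVec_smul, Matrix.mulVec_sub, Matrix.mulVec_smul, Matrix.mulVec_smul, hVa,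
      hVb, smul_smul, smul_smul, mul_comm l, sub_self, smul_zero]
  have hgg : g ⬝ᵥ g = 1 := by
    rw [hg]
    simp only [smul_dotProduct, dotProduct_smul, smul_eq_mul, sub_dotProduct, dotProduct_sub,
      dotProduct_comm b a, hab, haa, hyy, hbb]
    linear_combination hμinv
  have hBf : (B *ᵥ f) ⬝ᵥ (B *ᵥ f) = X + Y := by
    rw [hfab, Matrix.mulVec_add, add_dotProduct, dotProduct_add, dotProduct_add,
      dotProduct_comm (B *ᵥ b) (B *ᵥ a), horth]
    ring
  have hBg : (l * (1 - l)) * ((B *ᵥ g) ⬝ᵥ (B *ᵥ g)) = (1 - l) ^ 2 * Y + l ^ 2 * X := by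
    rw [hg]
    simp only [Matrix.mulVec_smul, Matrix.mulVec_sub, smul_dotProduct, dotProduct_smul,
      smul_eq_mul, sub_dotProduct, dotProduct_sub, dotProduct_comm (B *ᵥ b) (B *ᵥ a), horth]
    linear_combination ((1 - l) ^ 2 * Y + l ^ 2 * X) * hμinv
  set G := (B *ᵥ g) ⬝ᵥ (B *ᵥ g) with hG
  obtain ⟨e, he0, h1, h2⟩ := hE.sqrt_le hA0 ⟨z, hf⟩ hVg hf1 hgg hAf
  rw [hBf] at h1
  exact sin_sq_le_of_quadratic_forms hl0 hl1 hs hcs hX0 hY0 hXY hBg he0 h1 h2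

/-- Perturbation bound for the leading right singular subspaces of `A` and `B`. -/
theorem cosineBound_of_splitNormBound {A B : Matrix m n ℝ} {V : Matrix n (Fin A.rank) ℝ}
    (hV : IsTopRightSingularVectors A V) {W : Matrix n (Fin A.rank) ℝ}
    (hW : IsTopRightSingularVectors B W) {c : ℝ} (hE : SplitNormBound (B - A) V c) :
    CosineBound V W (c / singularValue A A.rank) := by
  intro z
  rcases Nat.eq_zero_or_pos A.rank with h0 | h0
  · have : IsEmpty (Fin A.rank) := by rw [h0]; infer_instance
    simp [dotProduct]
  have hs := singularValue_rank_pos A h0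
  set s := singularValue A A.rank with hsdef
  -- If `c ≥ s` then `1 - (c / s)² ≤ 0` and the bound is trivial.
  rcases le_or_gt s c with hcs | hcs
  · have h1 : 1 ≤ c / s := (one_le_div hs).2 hcs
    have h2 : 1 - (c / s) ^ 2 ≤ 0 := by nlinarith
    exact (mul_nonpos_of_nonpos_of_nonneg h2 (dotProduct_self_nonneg_real z)).trans
      (dotProduct_self_nonneg_real _)
  set C := Wᵀ * V with hC
  -- The claim is that `M` is positive semidefinite. An eigenvector of `M` for `λ` is one of `1 -
  -- CᵀC` for `(c / s)² - λ`, a squared sine at most `(c / s)²`, so `λ ≥ 0`.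
  set M : Matrix (Fin A.rank) (Fin A.rank) ℝ := ((c / s) ^ 2 - 1) • (1 : Matrix _ _ ℝ) + Cᵀ * C
    with hM
  have hMz (z : Fin A.rank → ℝ) : M *ᵥ z = ((c / s) ^ 2 - 1) • z + Cᵀ *ᵥ (C *ᵥ z) := by
    rw [hM, Matrix.add_mulVec, Matrix.smul_mulVec, Matrix.one_mulVec, Matrix.mulVec_mulVec]
  have hherm : M.IsHermitian := by
    rw [Matrix.IsHermitian, Matrix.conjTranspose_eq_transpose_of_trivial, hM]
    simp [Matrix.transpose_mul]
  have hpsd : M.PosSemidef := by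
    rw [hherm.posSemidef_iff_eigenvalues_nonneg]
    intro i
    have hev := hherm.mulVec_eigenvectorBasis i
    set v : Fin A.rank → ℝ := (hherm.eigenvectorBasis i).ofLp with hv
    have hvv : v ⬝ᵥ v = 1 := by
      have h1 := norm_sq_toLp v
      have h2 := hherm.eigenvectorBasis.orthonormal.1 i
      rw [← h1, hv]
      simp [h2]
    rw [hMz] at hev
    have hl : v - Vᵀ *ᵥ (W *ᵥ (Wᵀ *ᵥ (V *ᵥ v))) = ((c / s) ^ 2 - hherm.eigenvalues i) • v := by
      have h1 : Cᵀ *ᵥ (C *ᵥ v) = Vᵀ *ᵥ (W *ᵥ (Wᵀ *ᵥ (V *ᵥ v))) := by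
        rw [hC, Matrix.transpose_mul, Matrix.transpose_transpose, ← Matrix.mulVec_mulVec,
          ← Matrix.mulVec_mulVec]
      rw [← h1, sub_smul, ← hev, sub_smul, one_smul]
      abel
    have := sin_sq_le_of_eigenvector hV.1 hW hs hcs hV.le_norm_sq_mulVec
      (fun b hb => hV.mulVec_eq_zero hb) hE hvv hl
    simp only [Pi.zero_apply]
    linarith
  have h1 := hpsd.dotProduct_mulVec_nonneg z
  rw [hMz, star_trivial, dotProduct_add, dotProduct_smul, smul_eq_mul,
    Matrix.dotProduct_mulVec z Cᵀ, Matrix.vecMul_transpose, hC, ← Matrix.mulVec_mulVec] at h1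
  linarith

end Perturbation

/-! ### The test statistic -/

section TestStatistic

lemma frobeniusSq_eq_sum {m n : Type*} [Fintype m] [Fintype n] [DecidableEq n]
    (A : Matrix m n ℝ) :
    frobeniusSq A = ∑ j, (A *ᵥ Pi.single j 1) ⬝ᵥ (A *ᵥ Pi.single j 1) := by
  rw [frobeniusSq, Finset.sum_comm]
  simp [dotProduct, Matrix.col, sq]

lemma frobeniusSq_transpose {m n : Type*} [Fintype m] [Fintype n] (A : Matrix m n ℝ) :
    frobeniusSq Aᵀ = frobeniusSq A := by
  rw [frobeniusSq, frobeniusSq, Finset.sum_comm]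
  rfl

variable {n k l : Type*} [Fintype n] [Fintype k] [Fintype l] [DecidableEq k] [DecidableEq l]

lemma frobeniusSq_of_orthonormal {V : Matrix n l ℝ} (hV : Vᵀ * V = 1) :
    frobeniusSq V = Fintype.card l := by
  simp only [frobeniusSq_eq_sum, mulVec_dotProduct_mulVec_self hV]
  simp

lemma norm_sq_compl_mulVec [DecidableEq n] {V : Matrix n k ℝ} (hV : Vᵀ * V = 1) (x : n → ℝ) :
    ((1 - V * Vᵀ) *ᵥ x) ⬝ᵥ ((1 - V * Vᵀ) *ᵥ x) = x ⬝ᵥ x - (Vᵀ *ᵥ x) ⬝ᵥ (Vᵀ *ᵥ x) := by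
  have h : (1 - V * Vᵀ) *ᵥ x = x - V *ᵥ (Vᵀ *ᵥ x) := by
    rw [Matrix.sub_mulVec, Matrix.one_mulVec, Matrix.mulVec_mulVec]
  rw [h]
  simp only [sub_dotProduct, dotProduct_sub, mulVec_dotProduct_mulVec_self hV,
    dotProduct_comm x (V *ᵥ _)]
  simp only [mulVec_dotProduct_eq]
  ring

lemma norm_sq_transpose_mulVec_le {V : Matrix n k ℝ} (hV : Vᵀ * V = 1) (x : n → ℝ) :
    (Vᵀ *ᵥ x) ⬝ᵥ (Vᵀ *ᵥ x) ≤ x ⬝ᵥ x := by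
  classical
  have h := norm_sq_compl_mulVec hV x
  linarith [dotProduct_self_nonneg_real ((1 - V * Vᵀ) *ᵥ x)]

lemma testStatistic_eq [DecidableEq n] {V : Matrix n k ℝ} {W : Matrix n l ℝ} (hV : Vᵀ * V = 1)
    (hW : Wᵀ * W = 1) :
    testStatistic V W = Fintype.card l - frobeniusSq (Vᵀ * W) := by
  rw [testStatistic, frobeniusSq_eq_sum, frobeniusSq_eq_sum]
  simp only [← Matrix.mulVec_mulVec, norm_sq_compl_mulVec hV, mulVec_dotProduct_mulVec_self hW,
    Finset.sum_sub_distrib]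
  simp

/-- The component of a vector in one of the leading singular subspaces is close to the component
in the other one. -/
lemma CosineBound.sqrt_le {n : Type*} [Fintype n] {k : ℕ} {V W : Matrix n (Fin k) ℝ} {a : ℝ}
    (h : CosineBound V W a) (ha : 0 ≤ a) (hV : Vᵀ * V = 1) (hW : Wᵀ * W = 1) (x : n → ℝ) :
    √((Vᵀ *ᵥ x) ⬝ᵥ (Vᵀ *ᵥ x)) ≤ √((Wᵀ *ᵥ x) ⬝ᵥ (Wᵀ *ᵥ x)) + a * √(x ⬝ᵥ x) := by
  classical
  set P := (1 - W * Wᵀ) with hP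
  have hsplit : Vᵀ *ᵥ x = Vᵀ *ᵥ (W *ᵥ (Wᵀ *ᵥ x)) + Vᵀ *ᵥ (P *ᵥ x) := by
    rw [← Matrix.mulVec_add, hP, Matrix.sub_mulVec, Matrix.one_mulVec, ← Matrix.mulVec_mulVec]
    congr 1
    abel
  have h1 : √((Vᵀ *ᵥ (W *ᵥ (Wᵀ *ᵥ x))) ⬝ᵥ (Vᵀ *ᵥ (W *ᵥ (Wᵀ *ᵥ x)))) ≤
      √((Wᵀ *ᵥ x) ⬝ᵥ (Wᵀ *ᵥ x)) := by
    refine Real.sqrt_le_sqrt ((norm_sq_transpose_mulVec_le hV _).trans (le_of_eq ?_))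
    rw [mulVec_dotProduct_mulVec_self hW]
  have hPt : Pᵀ = P := by simp [hP, Matrix.transpose_mul]
  set y := Vᵀ *ᵥ (P *ᵥ x) with hy
  -- By duality `‖y‖² = ⟨P V y, x⟩`, and the cosine bound with Pythagoras gives `‖P V y‖ ≤ a ‖y‖`.
  have h2 : √(y ⬝ᵥ y) ≤ a * √(x ⬝ᵥ x) := by
    have e1 : y ⬝ᵥ y = (P *ᵥ (V *ᵥ y)) ⬝ᵥ x := by
      nth_rw 2 [hy]
      rw [← mulVec_dotProduct_eq, mulVec_dotProduct_eq P, hPt]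
    have e2 := dotProduct_le_sqrt_mul_sqrt (P *ᵥ (V *ᵥ y)) x
    have e3 : (P *ᵥ (V *ᵥ y)) ⬝ᵥ (P *ᵥ (V *ᵥ y)) ≤ a ^ 2 * (y ⬝ᵥ y) := by
      rw [hP, norm_sq_compl_mulVec hW, mulVec_dotProduct_mulVec_self hV]
      linarith [h y]
    have e4 : √((P *ᵥ (V *ᵥ y)) ⬝ᵥ (P *ᵥ (V *ᵥ y))) ≤ a * √(y ⬝ᵥ y) := by
      refine (Real.sqrt_le_sqrt e3).trans (le_of_eq ?_)
      rw [Real.sqrt_mul (sq_nonneg a), Real.sqrt_sq ha]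
    have e5 : √(y ⬝ᵥ y) * √(y ⬝ᵥ y) ≤ √(y ⬝ᵥ y) * (a * √(x ⬝ᵥ x)) := by
      rw [Real.mul_self_sqrt (dotProduct_self_nonneg_real y)]
      nlinarith [mul_le_mul_of_nonneg_right e4 (Real.sqrt_nonneg (x ⬝ᵥ x))]
    rcases (Real.sqrt_nonneg (y ⬝ᵥ y)).eq_or_lt with h0 | h0
    · rw [← h0]; positivity
    · exact le_of_mul_le_mul_left e5 h0
  rw [hsplit]
  exact (sqrt_dotProduct_add_le _ _).trans (add_le_add h1 h2)

/-- The two norms differ by at most `a` in this direction and neither exceeds `1`, so factoring the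
difference of squares costs a factor 2. This is the origin of the term of `τ(α)` linear in `σ`. -/
lemma CosineBound.norm_sq_le {n : Type*} [Fintype n] {k : ℕ} {V W : Matrix n (Fin k) ℝ} {a : ℝ}
    (h : CosineBound V W a) (ha : 0 ≤ a) (hV : Vᵀ * V = 1) (hW : Wᵀ * W = 1) {x : n → ℝ}
    (hx : x ⬝ᵥ x = 1) :
    (Vᵀ *ᵥ x) ⬝ᵥ (Vᵀ *ᵥ x) ≤ (Wᵀ *ᵥ x) ⬝ᵥ (Wᵀ *ᵥ x) + 2 * a := by
  have h1 := h.sqrt_le ha hV hW x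
  have h2 : √((Vᵀ *ᵥ x) ⬝ᵥ (Vᵀ *ᵥ x)) ≤ 1 :=
    Real.sqrt_le_one.2 (hx ▸ norm_sq_transpose_mulVec_le hV x)
  have h3 : √((Wᵀ *ᵥ x) ⬝ᵥ (Wᵀ *ᵥ x)) ≤ 1 :=
    Real.sqrt_le_one.2 (hx ▸ norm_sq_transpose_mulVec_le hW x)
  rw [hx, Real.sqrt_one, mul_one] at h1
  have h4 := Real.sq_sqrt (dotProduct_self_nonneg_real (Vᵀ *ᵥ x))
  have h5 := Real.sq_sqrt (dotProduct_self_nonneg_real (Wᵀ *ᵥ x))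
  have h6 := Real.sqrt_nonneg ((Vᵀ *ᵥ x) ⬝ᵥ (Vᵀ *ᵥ x))
  have h7 := Real.sqrt_nonneg ((Wᵀ *ᵥ x) ⬝ᵥ (Wᵀ *ᵥ x))
  nlinarith

lemma mul_transpose_mul_eq_of_columnSpan_le {l : Type*} {V : Matrix n k ℝ} {W : Matrix n l ℝ}
    (hV : Vᵀ * V = 1) (h : columnSpan W ≤ columnSpan V) : V * (Vᵀ * W) = W := by
  ext i j
  have hj : W.col j ∈ columnSpan V := h (Submodule.subset_span ⟨j, rfl⟩)
  rw [columnSpan, ← Matrix.range_mulVecLin] at hj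
  obtain ⟨z, hz⟩ := hj
  rw [Matrix.mulVecLin_apply] at hz
  have hz' : V *ᵥ (Vᵀ *ᵥ (W.col j)) = W.col j := by
    rw [← hz, Matrix.mulVec_mulVec z, hV, Matrix.one_mulVec]
  exact congrFun hz' i

lemma norm_sq_transpose_mulVec_le_of_columnSpan_le {V : Matrix n k ℝ} {W : Matrix n l ℝ}
    (hV : Vᵀ * V = 1) (hW : Wᵀ * W = 1) (h : columnSpan W ≤ columnSpan V) (x : n → ℝ) :
    (Wᵀ *ᵥ x) ⬝ᵥ (Wᵀ *ᵥ x) ≤ (Vᵀ *ᵥ x) ⬝ᵥ (Vᵀ *ᵥ x) := by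
  have hVW := mul_transpose_mul_eq_of_columnSpan_le hV h
  have hR : (Vᵀ * W)ᵀ * (Vᵀ * W) = 1 := by
    rw [Matrix.transpose_mul, Matrix.transpose_transpose, Matrix.mul_assoc, hVW, hW]
  have h1 : Wᵀ *ᵥ x = (Vᵀ * W)ᵀ *ᵥ (Vᵀ *ᵥ x) := by
    rw [Matrix.mulVec_mulVec, ← Matrix.transpose_mul, hVW]
  rw [h1]
  exact norm_sq_transpose_mulVec_le hR _

lemma frobeniusSq_mul_transpose_mul_of_columnSpan_le {Vp : Matrix n k ℝ}
    {Vq : Matrix n l ℝ} (hVp : Vpᵀ * Vp = 1) (hVq : Vqᵀ * Vq = 1)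
    (hspan : columnSpan Vq ≤ columnSpan Vp) :
    frobeniusSq (Vp * Vpᵀ * Vq) = Fintype.card l := by
  rw [Matrix.mul_assoc, mul_transpose_mul_eq_of_columnSpan_le hVp hspan,
    frobeniusSq_of_orthonormal hVq]

variable [DecidableEq n] {p q : ℕ} {Vp Wp : Matrix n (Fin p) ℝ} {Vq Wq : Matrix n (Fin q) ℝ}
  {a b : ℝ}

/-- Upper bound for the test statistic when the column spans are nested. -/
theorem testStatistic_le_of_columnSpan_le (hVp : Vpᵀ * Vp = 1) (hWp : Wpᵀ * Wp = 1)
    (hVq : Vqᵀ * Vq = 1) (hWq : Wqᵀ * Wq = 1) (ha : 0 ≤ a) (hp : CosineBound Vp Wp a)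
    (hq : CosineBound Vq Wq b) (hspan : columnSpan Vq ≤ columnSpan Vp) :
    testStatistic Wp Wq ≤ q * (b ^ 2 + 2 * a) := by
  rw [testStatistic_eq hWp hWq, frobeniusSq_eq_sum, Fintype.card_fin]
  have h : ∑ _j : Fin q, (1 - (b ^ 2 + 2 * a)) ≤
      ∑ j, ((Wpᵀ * Wq) *ᵥ Pi.single j 1) ⬝ᵥ ((Wpᵀ * Wq) *ᵥ Pi.single j 1) := by
    -- For a column `w` of `Wq`: `‖Wpᵀ w‖² ≥ ‖Vpᵀ w‖² - 2a ≥ ‖Vqᵀ w‖² - 2a ≥ 1 - b² - 2a`, where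
    -- nestedness is the middle inequality.
    refine Finset.sum_le_sum fun j _ => ?_
    rw [← Matrix.mulVec_mulVec]
    have hunit : (Wq *ᵥ Pi.single j 1) ⬝ᵥ (Wq *ᵥ Pi.single j 1) = 1 := by
      rw [mulVec_dotProduct_mulVec_self hWq]; simp
    have h1 := hp.norm_sq_le ha hVp hWp hunit
    have h2 := norm_sq_transpose_mulVec_le_of_columnSpan_le hVp hVq hspan (Wq *ᵥ Pi.single j 1)
    have h3 := hq.symm (Pi.single j 1)
    simp only [single_one_dotProduct, Pi.single_eq_same, mul_one] at h3
    linarith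
  simp only [Finset.sum_const, Finset.card_univ, Fintype.card_fin, nsmul_eq_mul] at h
  linarith

/-- Lower bound for the test statistic. -/
theorem le_testStatistic (hVp : Vpᵀ * Vp = 1) (hWp : Wpᵀ * Wp = 1)
    (hVq : Vqᵀ * Vq = 1) (hWq : Wqᵀ * Wq = 1) (ha : 0 ≤ a) (hb : 0 ≤ b)
    (hp : CosineBound Vp Wp a) (hq : CosineBound Vq Wq b) :
    q - frobeniusSq (Vp * Vpᵀ * Vq) - q * (2 * a) - q * (2 * b) ≤ testStatistic Wp Wq := by
  rw [testStatistic_eq hWp hWq, Fintype.card_fin]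
  have hfrob : frobeniusSq (Vp * Vpᵀ * Vq) = frobeniusSq (Vpᵀ * Vq) := by
    rw [frobeniusSq_eq_sum, frobeniusSq_eq_sum]
    simp only [Matrix.mul_assoc, ← Matrix.mulVec_mulVec, mulVec_dotProduct_mulVec_self hVp]
  -- Right multiplication by the contraction `Vqᵀ * Wq` does not increase the Frobenius norm;
  -- transposing turns this into a statement about columns.
  have hmul : frobeniusSq (Vpᵀ * Vq * (Vqᵀ * Wq)) ≤ frobeniusSq (Vpᵀ * Vq) := by
    rw [← frobeniusSq_transpose, ← frobeniusSq_transpose (Vpᵀ * Vq), frobeniusSq_eq_sum,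
      frobeniusSq_eq_sum]
    refine Finset.sum_le_sum fun j _ => ?_
    rw [Matrix.transpose_mul, ← Matrix.mulVec_mulVec, Matrix.transpose_mul Vqᵀ,
      Matrix.transpose_transpose, ← Matrix.mulVec_mulVec]
    refine (norm_sq_transpose_mulVec_le hWq _).trans (le_of_eq ?_)
    rw [mulVec_dotProduct_mulVec_self hVq]
  have hcol : ∀ j : Fin q, ((Wpᵀ * Wq) *ᵥ Pi.single j 1) ⬝ᵥ ((Wpᵀ * Wq) *ᵥ Pi.single j 1) ≤
      ((Vpᵀ * Vq * (Vqᵀ * Wq)) *ᵥ Pi.single j 1) ⬝ᵥ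
        ((Vpᵀ * Vq * (Vqᵀ * Wq)) *ᵥ Pi.single j 1) + (2 * a + 2 * b) := fun j => by
    set w := Wq *ᵥ Pi.single j 1 with hw
    have hunit : w ⬝ᵥ w = 1 := by rw [hw, mulVec_dotProduct_mulVec_self hWq]; simp
    rw [← Matrix.mulVec_mulVec, ← hw]
    have h1 := hp.symm.norm_sq_le ha hWp hVp hunit
    set x := (Vpᵀ * Vq * (Vqᵀ * Wq)) *ᵥ Pi.single j 1 with hx
    have hx' : x = Vpᵀ *ᵥ (Vq *ᵥ (Vqᵀ *ᵥ w)) := by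
      simp only [hx, hw, Matrix.mulVec_mulVec, Matrix.mul_assoc]
    -- The part of the estimated column outside the true post-period subspace, of norm at most `b`.
    -- Dropping it changes the squared norm by at most `2b`, as both norms are at most `1`.
    set r := (1 - Vq * Vqᵀ) *ᵥ w with hr
    have hsplit : Vpᵀ *ᵥ w = x + Vpᵀ *ᵥ r := by
      rw [hx', ← Matrix.mulVec_add, hr, Matrix.sub_mulVec, Matrix.one_mulVec,
        ← Matrix.mulVec_mulVec]
      congr 1
      abel
    have hrb : √((Vpᵀ *ᵥ r) ⬝ᵥ (Vpᵀ *ᵥ r)) ≤ b := by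
      refine Real.sqrt_le_iff.2 ⟨hb, (norm_sq_transpose_mulVec_le hVp r).trans ?_⟩
      have h3 := hq.symm (Pi.single j 1)
      rw [← hw] at h3
      simp only [single_one_dotProduct, Pi.single_eq_same, mul_one] at h3
      rw [hr, norm_sq_compl_mulVec hVq, hunit]
      linarith
    have h2 := sqrt_dotProduct_add_le x (Vpᵀ *ᵥ r)
    rw [← hsplit] at h2
    have h4 : √((Vpᵀ *ᵥ w) ⬝ᵥ (Vpᵀ *ᵥ w)) ≤ 1 :=
      Real.sqrt_le_one.2 (hunit ▸ norm_sq_transpose_mulVec_le hVp w)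
    have h5 : √(x ⬝ᵥ x) ≤ 1 := by
      refine Real.sqrt_le_one.2 ?_
      rw [hx']
      refine (norm_sq_transpose_mulVec_le hVp _).trans ?_
      rw [mulVec_dotProduct_mulVec_self hVq, ← hunit]
      exact norm_sq_transpose_mulVec_le hVq w
    have h6 := Real.sq_sqrt (dotProduct_self_nonneg_real (Vpᵀ *ᵥ w))
    have h7 := Real.sq_sqrt (dotProduct_self_nonneg_real x)
    have h8 := Real.sqrt_nonneg ((Vpᵀ *ᵥ w) ⬝ᵥ (Vpᵀ *ᵥ w))
    have h9 := Real.sqrt_nonneg (x ⬝ᵥ x)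
    nlinarith
  have hsum := Finset.sum_le_sum fun j (_ : j ∈ Finset.univ) => hcol j
  rw [← frobeniusSq_eq_sum, Finset.sum_add_distrib, ← frobeniusSq_eq_sum] at hsum
  simp only [Finset.sum_const, Finset.card_univ, Fintype.card_fin, nsmul_eq_mul] at hsum
  rw [hfrob]
  linarith

end TestStatistic

/-! ### Conditioning on a random variable -/

section Conditioning

variable {Ω E : Type*} [mΩ : MeasurableSpace Ω] [StandardBorelSpace Ω] [mE : MeasurableSpace E]
  {μ : Measure Ω} [IsProbabilityMeasure μ]

lemma measurableEq_prod {α β : Type*} [MeasurableSpace α] [MeasurableSpace β] [MeasurableEq α]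
    [MeasurableEq β] : MeasurableEq (α × β) := by
  constructor
  have h : Set.diagonal (α × β) = {p | p.1.1 = p.2.1} ∩ {p | p.1.2 = p.2.2} := by
    ext p
    simp [Prod.ext_iff]
  rw [h]
  exact (measurableSet_eq_fun (by fun_prop) (by fun_prop)).inter
    (measurableSet_eq_fun (by fun_prop) (by fun_prop))

/-- Under the conditional probability given `f`, the random variable `f` is constant. -/
lemma ae_condExpKernel_comap_eq [MeasurableEq E] {f : Ω → E}
    (hf : Measurable f) :
    ∀ᵐ ω ∂μ, ∀ᵐ ω' ∂condExpKernel μ (mE.comap f) ω, f ω = f ω' := by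
  have hm : mE.comap f ≤ mΩ := hf.comap_le
  -- Composing `μ` with the kernel gives the law of the pair `(ω, ω)`, for which the equality is
  -- trivial. The first factor carries only the σ-algebra generated by `f`.
  refine ae_of_ae_trim hm (Measure.ae_ae_of_ae_compProd (p := fun p : Ω × Ω => f p.1 = f p.2) ?_)
  rw [compProd_trim_condExpKernel hm]
  have hset : MeasurableSet[(mE.comap f).prod mΩ] {p : Ω × Ω | f p.1 = f p.2} := by
    have h1 : @Measurable (Ω × Ω) (E × E) ((mE.comap f).prod mΩ) _
        fun p => (f p.1, f p.2) :=
      Measurable.prodMk ((comap_measurable f).comp (@measurable_fst Ω Ω (mE.comap f) mΩ))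
        (hf.comp (@measurable_snd Ω Ω (mE.comap f) mΩ))
    exact h1 measurableSet_diagonal
  have hdm : @Measurable Ω (Ω × Ω) mΩ ((mE.comap f).prod mΩ) Function.diag :=
    Measurable.prodMk (measurable_id'' hm) measurable_id
  have hda := @Measurable.aemeasurable Ω (Ω × Ω) mΩ ((mE.comap f).prod mΩ) Function.diag μ hdm
  exact (@ae_map_iff Ω (Ω × Ω) mΩ ((mE.comap f).prod mΩ) μ Function.diag hda _
    hset).2 (Filter.Eventually.of_forall fun ω => rfl)

/-- The kernel evaluated on a set is measurable for the σ-algebra of `f`, so its level sets are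
preimages under `f`. The equality holds at every point, with no exceptional set. -/
lemma condExpKernel_comap_congr {f : Ω → E} {ω ω' : Ω} (h : f ω = f ω') :
    condExpKernel μ (mE.comap f) ω = condExpKernel μ (mE.comap f) ω' := by
  ext s hs
  obtain ⟨t, -, ht⟩ := measurable_condExpKernel (μ := μ) (m := mE.comap f) hs
    (measurableSet_singleton (condExpKernel μ (mE.comap f) ω' s))
  have h1 : ω' ∈ f ⁻¹' t := by rw [ht]; rfl
  have h2 : ω ∈ f ⁻¹' t := by rw [Set.mem_preimage, h]; exact h1
  rw [ht] at h2
  exact h2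

end Conditioning

/-! ### Families of independent centered normal variables -/

section NoiseMatrix

lemma pi_gaussianReal_eq_map {ι : Type*} [Fintype ι] (σ : ℝ≥0) :
    Measure.pi (fun _ : ι => gaussianReal 0 (σ ^ 2)) =
      (stdNormal ι).map fun ζ i => (σ : ℝ) * ζ i := by
  have h : (gaussianReal 0 1).map ((σ : ℝ) * ·) = gaussianReal 0 (σ ^ 2) := by
    rw [gaussianReal_map_const_mul, mul_zero, mul_one]
    congr 1
  have : ∀ _ : ι, SigmaFinite ((gaussianReal 0 1).map ((σ : ℝ) * ·)) := fun _ => by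
    rw [h]; infer_instance
  rw [stdNormal, Measure.pi_map_pi fun _ => by fun_prop, h]

lemma not_splitNormBound_iff {m n : Type*} [Fintype m] [Fintype n] {k : ℕ} {E : Matrix m n ℝ}
    {V : Matrix n (Fin k) ℝ} {c : ℝ} :
    ¬ SplitNormBound E V c ↔ ∃ f ∈ {f | ∃ z, f = V *ᵥ z}, ∃ g ∈ {g | Vᵀ *ᵥ g = 0},
      f ⬝ᵥ f = 1 ∧ g ⬝ᵥ g = 1 ∧
        c < √((E *ᵥ f) ⬝ᵥ (E *ᵥ f)) + √((E *ᵥ g) ⬝ᵥ (E *ᵥ g)) := by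
  simp only [SplitNormBound, not_forall, not_le, exists_prop, Set.mem_ofPred_eq]
  constructor
  · rintro ⟨f, g, h1, h2, h3, h4, h5⟩
    exact ⟨f, h1, g, h2, h3, h4, h5⟩
  · rintro ⟨f, h1, g, h2, h3, h4, h5⟩
    exact ⟨f, g, h1, h2, h3, h4, h5⟩

lemma isOpen_not_splitNormBound {m n : Type*} [Fintype m] [Fintype n] {k : ℕ}
    (V : Matrix n (Fin k) ℝ) (c : ℝ) :
    IsOpen {ζ : m × n → ℝ | ¬ SplitNormBound (Matrix.of fun i j => ζ (i, j)) V c} := by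
  simp only [not_splitNormBound_iff, Set.ofPred_exists, Set.ofPred_and]
  refine isOpen_iUnion fun f => isOpen_const.inter <| isOpen_iUnion fun g => isOpen_const.inter <|
    isOpen_const.inter <| isOpen_const.inter <| isOpen_lt continuous_const ?_
  simp only [dotProduct, Matrix.mulVec, Matrix.of_apply]
  fun_prop

/-- Deviation inequality for a matrix of independent centered normal variables. -/
lemma measure_not_splitNormBound_le {Ω m n : Type*} [MeasurableSpace Ω] [Fintype m] [Fintype n]
    {ν : Measure Ω} [IsProbabilityMeasure ν] {X : m × n → Ω → ℝ} (hX : ∀ p, Measurable (X p))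
    (hind : iIndepFun X ν) (σ : ℝ≥0) (hlaw : ∀ p, ν.map (X p) = gaussianReal 0 (σ ^ 2)) {k : ℕ}
    (V : Matrix n (Fin k) ℝ) {s : ℝ} (hs : 0 < s) :
    ν {ω | ¬ SplitNormBound (Matrix.of fun i j => X (i, j) ω) V
        (2 * σ * (√(Fintype.card m) + √(Fintype.card n) + s))} ≤
      ENNReal.ofReal (Real.exp (-s ^ 2)) := by
  have hmap : ν.map (fun ω p => X p ω) = (stdNormal (m × n)).map fun ζ p => (σ : ℝ) * ζ p := by
    rw [← pi_gaussianReal_eq_map, (iIndepFun_iff_map_fun_eq_pi_map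
      fun p => (hX p).aemeasurable).1 hind]
    congr 1
    funext p
    exact hlaw p
  set c := √(Fintype.card m) + √(Fintype.card n) + s with hc
  have hle := Measure.le_map_apply (μ := ν) (measurable_pi_lambda (fun ω p => X p ω) hX).aemeasurable
    {ζ : m × n → ℝ | ¬ SplitNormBound (Matrix.of fun i j => ζ (i, j)) V (2 * σ * c)}
  refine hle.trans ?_
  rw [hmap, Measure.map_apply (by fun_prop) (isOpen_not_splitNormBound V _).measurableSet]
  refine (measure_mono fun ζ hζ => ?_).trans (stdNormal_exists_lt_norm_add_norm_le
    (S₁ := {f | ∃ z, f = V *ᵥ z}) (S₂ := {g | Vᵀ *ᵥ g = 0}) (fun f hf g hg => by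
      obtain ⟨z, rfl⟩ := hf
      rw [mulVec_dotProduct_eq, hg, dotProduct_zero]) hs)
  rw [Set.mem_preimage, Set.mem_ofPred_eq, not_splitNormBound_iff] at hζ
  obtain ⟨f, hf, g, hg, hf1, hg1, h⟩ := hζ
  refine ⟨f, hf, g, hg, hf1, hg1, ?_⟩
  have hscale (x : n → ℝ) : √(((Matrix.of fun i j => (σ : ℝ) * ζ (i, j)) *ᵥ x) ⬝ᵥ
      ((Matrix.of fun i j => (σ : ℝ) * ζ (i, j)) *ᵥ x)) =
      σ * √(((Matrix.of fun i j => ζ (i, j)) *ᵥ x) ⬝ᵥ ((Matrix.of fun i j => ζ (i, j)) *ᵥ x)) := by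
    have h1 : (Matrix.of fun (i : m) (j : n) => (σ : ℝ) * ζ (i, j)) =
        (σ : ℝ) • Matrix.of fun i j => ζ (i, j) := rfl
    rw [h1, Matrix.smul_mulVec, smul_dotProduct, dotProduct_smul, smul_eq_mul, smul_eq_mul,
      ← mul_assoc, Real.sqrt_mul (mul_self_nonneg _), Real.sqrt_mul_self (NNReal.coe_nonneg σ)]
  rw [hscale, hscale, ← mul_add, mul_right_comm, mul_comm] at h
  exact lt_of_mul_lt_mul_left h (NNReal.coe_nonneg σ)

end NoiseMatrix

/-! ### Error bounds on the event that the noise is small -/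

section ErrorBounds

/-- The columns of a panel for the units with treatment `d`. -/
def groupMatrix {T N D : ℕ} (assign : Fin N → Fin D) (d : Fin D) (Y : Fin T → Fin N → ℝ) :
    Matrix (Fin T) {n : Fin N // assign n = d} ℝ :=
  Matrix.of fun t j => Y t j.1

variable {T₀ T₁ N D : ℕ} {d : Fin D}

/-- The critical value, as a function of the mean matrices. -/
def critValue (assign : Fin N → Fin D) (d : Fin D) (A₀ : Fin T₀ → Fin N → ℝ)
    (A₁ : Fin T₁ → Fin N → ℝ) (C : ℝ) (σ : ℝ≥0) (α : ℝ) : ℝ :=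
  C * σ ^ 2 * (groupMatrix assign d A₁).rank *
      phi T₀ (Fintype.card {n : Fin N // assign n = d}) (α / 2) ^ 2 /
      singularValue (groupMatrix assign d A₀) (groupMatrix assign d A₀).rank ^ 2
  + C * σ ^ 2 * (groupMatrix assign d A₁).rank *
      phi T₁ (Fintype.card {n : Fin N // assign n = d}) (α / 2) ^ 2 /
      singularValue (groupMatrix assign d A₁) (groupMatrix assign d A₁).rank ^ 2
  + C * σ * (groupMatrix assign d A₁).rank *
      phi T₀ (Fintype.card {n : Fin N // assign n = d}) (α / 2) /
      singularValue (groupMatrix assign d A₀) (groupMatrix assign d A₀).rank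

lemma phi_nonneg (T n : ℕ) (a : ℝ) : 0 ≤ phi T n a := by unfold phi; positivity

/-- On the event that the noise is small, the test decides correctly. The assignment and the means
that enter the estimates are allowed to be only propositionally equal to the true ones. -/
theorem testStatistic_bounds {assign assign' : Fin N → Fin D} {A₀ A₀' : Fin T₀ → Fin N → ℝ}
    {A₁ A₁' : Fin T₁ → Fin N → ℝ} (hassign : assign' = assign) (hA₀ : A₀' = A₀) (hA₁ : A₁' = A₁)
    {Y₀ : Fin T₀ → Fin N → ℝ} {Y₁ : Fin T₁ → Fin N → ℝ} (σ : ℝ≥0) (α : ℝ)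
    {Vpre : Matrix _ (Fin (groupMatrix assign d A₀).rank) ℝ}
    (hVpre : IsTopRightSingularVectors (groupMatrix assign d A₀) Vpre)
    {Vpost : Matrix _ (Fin (groupMatrix assign d A₁).rank) ℝ}
    (hVpost : IsTopRightSingularVectors (groupMatrix assign d A₁) Vpost)
    {Wpre : Matrix _ (Fin (groupMatrix assign' d A₀').rank) ℝ}
    (hWpre : IsTopRightSingularVectors (groupMatrix assign' d Y₀) Wpre)
    {Wpost : Matrix _ (Fin (groupMatrix assign' d A₁').rank) ℝ}
    (hWpost : IsTopRightSingularVectors (groupMatrix assign' d Y₁) Wpost)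
    (hpre : SplitNormBound (groupMatrix assign d Y₀ - groupMatrix assign d A₀) Vpre
      (2 * σ * phi T₀ (Fintype.card {n : Fin N // assign n = d}) (α / 2)))
    (hpost : SplitNormBound (groupMatrix assign d Y₁ - groupMatrix assign d A₁) Vpost
      (2 * σ * phi T₁ (Fintype.card {n : Fin N // assign n = d}) (α / 2))) :
    (columnSpan Vpost ≤ columnSpan Vpre →
      testStatistic Wpre Wpost ≤ critValue assign' d A₀' A₁' 4 σ α) ∧
    (frobeniusSq (Vpre * Vpreᵀ * Vpost) + 2 * critValue assign d A₀ A₁ 4 σ α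
        + 4 * σ * (groupMatrix assign d A₁).rank *
          phi T₁ (Fintype.card {n : Fin N // assign n = d}) (α / 2) /
          singularValue (groupMatrix assign d A₁) (groupMatrix assign d A₁).rank <
        (groupMatrix assign d A₁).rank →
      critValue assign' d A₀' A₁' 4 σ α < testStatistic Wpre Wpost) := by
  -- The row indices and widths of the singular vector matrices depend on the assignment and the
  -- means; substitution gives both families the same types.
  subst hassign hA₀ hA₁
  have ha := cosineBound_of_splitNormBound hVpre hWpre hpre
  have hb := cosineBound_of_splitNormBound hVpost hWpost hpost
  unfold critValue
  set s := singularValue (groupMatrix assign' d A₀') (groupMatrix assign' d A₀').rank with hs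
  set s' := singularValue (groupMatrix assign' d A₁') (groupMatrix assign' d A₁').rank with hs'
  have hs0 : 0 ≤ s := singularValue_nonneg _ _
  have hs'0 : 0 ≤ s' := singularValue_nonneg _ _
  set φ := phi T₀ (Fintype.card {n : Fin N // assign' n = d}) (α / 2)
  set φ' := phi T₁ (Fintype.card {n : Fin N // assign' n = d}) (α / 2)
  have hφ : 0 ≤ φ := phi_nonneg _ _ _
  have hφ' : 0 ≤ φ' := phi_nonneg _ _ _
  set q : ℝ := ((groupMatrix assign' d A₁').rank : ℝ) with hq
  set a := 2 * σ * φ / s with hadef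
  set b := 2 * σ * φ' / s' with hbdef
  have ha0 : 0 ≤ a := by positivity
  have hb0 : 0 ≤ b := by positivity
  have hq0 : 0 ≤ q := Nat.cast_nonneg _
  -- With constant 4 the critical value is exactly `q (a² + b² + 2a)`. Under nested spans the term
  -- `q a²` is slack; otherwise one of the two copies of it absorbs the loss `2qa`.
  have e1 : 4 * σ ^ 2 * q * φ ^ 2 / s ^ 2 = q * a ^ 2 := by rw [hadef]; ring
  have e2 : 4 * σ ^ 2 * q * φ' ^ 2 / s' ^ 2 = q * b ^ 2 := by rw [hbdef]; ring
  have e3 : 4 * σ * q * φ / s = q * (2 * a) := by rw [hadef]; ring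
  have e4 : 4 * σ * q * φ' / s' = q * (2 * b) := by rw [hbdef]; ring
  rw [e1, e2, e3, e4]
  have h1 : 0 ≤ q * a ^ 2 := by positivity
  have h2 : 0 ≤ q * b ^ 2 := by positivity
  have h3 : 0 ≤ q * (2 * a) := by positivity
  have h4 : 0 ≤ q * (2 * b) := by positivity
  refine ⟨fun hspan => ?_, fun hlt => ?_⟩
  · have := testStatistic_le_of_columnSpan_le hVpre.1 hWpre.1 hVpost.1 hWpost.1 ha0 ha hb hspan
    rw [← hq] at this
    linarith
  · have := le_testStatistic hVpre.1 hWpre.1 hVpost.1 hWpost.1 ha0 hb0 ha hb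
    rw [← hq] at this
    linarith

end ErrorBounds

/-! ### The panel data model under the conditional probability -/

namespace PanelModel

variable {Ω : Type*} {T₀ T₁ N D r : ℕ}

/-- On a fibre of `ℰ` the factors and the assignment are fixed, so only the shock varies. -/
lemma exists_observed_eq_add_shock [NeZero D] {M : PanelModel Ω T₀ T₁ N D r} (hsutva : M.SUTVA)
    (hfactor : M.LatentFactorModel) (ω : Ω) (t : Fin (T₀ + T₁)) (n : Fin N) :
    ∃ c : ℝ, ∀ ω', M.conditioning ω = M.conditioning ω' →
      M.observed t n ω' = c + M.shock t n ω' := by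
  induction t using Fin.addCases with
  | left t =>
    refine ⟨M.u 0 (Fin.castAdd T₁ t) ω ⬝ᵥ M.v n ω, fun ω' h => ?_⟩
    have hu : M.u 0 (Fin.castAdd T₁ t) ω = M.u 0 (Fin.castAdd T₁ t) ω' :=
      congrFun (congrFun (congrArg Prod.fst h) 0) (Fin.castAdd T₁ t)
    have hv : M.v n ω = M.v n ω' := congrFun (congrArg (fun p => p.2.1) h) n
    rw [hsutva.1, hfactor, hu, hv]
  | right t =>
    refine ⟨M.u (M.assign n ω) (Fin.natAdd T₀ t) ω ⬝ᵥ M.v n ω, fun ω' h => ?_⟩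
    have ha : M.assign n ω = M.assign n ω' := congrFun (congrArg (fun p => p.2.2) h) n
    have hu : M.u (M.assign n ω) (Fin.natAdd T₀ t) ω = M.u (M.assign n ω) (Fin.natAdd T₀ t) ω' :=
      congrFun (congrFun (congrArg Prod.fst h) _) (Fin.natAdd T₀ t)
    have hv : M.v n ω = M.v n ω' := congrFun (congrArg (fun p => p.2.1) h) n
    rw [hsutva.2, hfactor, hu, hv, ha]

variable [MeasurableSpace Ω]

lemma IsMeasurable.measurable_conditioning {M : PanelModel Ω T₀ T₁ N D r} (h : M.IsMeasurable) :
    Measurable M.conditioning :=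
  (measurable_pi_lambda _ fun d => measurable_pi_lambda _ fun t => h.u d t).prodMk
    ((measurable_pi_lambda _ fun n => h.v n).prodMk (measurable_pi_lambda _ fun n => h.assign n))

variable [StandardBorelSpace Ω] {M : PanelModel Ω T₀ T₁ N D r} {μ : Measure Ω}
  [IsProbabilityMeasure μ]

instance (ω : Ω) : IsProbabilityMeasure (M.condProb μ ω) := by
  unfold condProb; infer_instance

lemma ae_conditioning_eq (hmeas : M.IsMeasurable) :
    ∀ᵐ ω ∂μ, ∀ᵐ ω' ∂M.condProb μ ω, M.conditioning ω = M.conditioning ω' := by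
  have : MeasurableEq ((Fin N → Fin r → ℝ) × (Fin N → Fin D)) := measurableEq_prod
  have : MeasurableEq ((Fin D → Fin (T₀ + T₁) → Fin r → ℝ) ×
      (Fin N → Fin r → ℝ) × (Fin N → Fin D)) := measurableEq_prod
  exact ae_condExpKernel_comap_eq hmeas.measurable_conditioning

lemma condProb_congr {ω ω' : Ω} (h : M.conditioning ω = M.conditioning ω') :
    M.condProb μ ω = M.condProb μ ω' :=
  condExpKernel_comap_congr h

/-- The constant on the fibre must be the conditional mean, because the shock is integrable with
mean zero. -/
lemma ae_observed_eq_integral_add_shock [NeZero D] (hmeas : M.IsMeasurable) (hsutva : M.SUTVA)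
    (hfactor : M.LatentFactorModel) {σ : ℝ≥0} {ω : Ω}
    (hlaw : ∀ t n, (M.condProb μ ω).map (M.shock t n) = gaussianReal 0 (σ ^ 2))
    (hω : ∀ᵐ ω' ∂M.condProb μ ω, M.conditioning ω = M.conditioning ω') :
    ∀ᵐ ω' ∂M.condProb μ ω, ∀ t n,
      M.observed t n ω' = (∫ ω'', M.observed t n ω'' ∂M.condProb μ ω) + M.shock t n ω' := by
  rw [ae_all_iff]; intro t
  rw [ae_all_iff]; intro n
  obtain ⟨c, hc⟩ := M.exists_observed_eq_add_shock hsutva hfactor ω t n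
  have hae : ∀ᵐ ω' ∂M.condProb μ ω, M.observed t n ω' = c + M.shock t n ω' := by
    filter_upwards [hω] with ω' h using hc ω' h
  have hint : Integrable (M.shock t n) (M.condProb μ ω) := by
    have h1 : Integrable id ((M.condProb μ ω).map (M.shock t n)) := by
      rw [hlaw]
      exact (memLp_id_gaussianReal 1).integrable (by simp)
    exact h1.comp_measurable (hmeas.shock t n)
  have hzero : ∫ ω', M.shock t n ω' ∂M.condProb μ ω = 0 := by
    have h1 := integral_map (hmeas.shock t n).aemeasurable (μ := M.condProb μ ω)
      (f := fun x : ℝ => x) (by fun_prop)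
    rw [hlaw, integral_id_gaussianReal] at h1
    exact h1.symm
  have hmean : ∫ ω', M.observed t n ω' ∂M.condProb μ ω = c := by
    rw [integral_congr_ae hae, integral_add (integrable_const c) hint, hzero]
    simp
  rw [hmean]
  exact hae

lemma lastSvPre_nonneg (d : Fin D) (ω : Ω) : 0 ≤ M.lastSvPre μ d ω := singularValue_nonneg _ _

lemma lastSvPost_nonneg (d : Fin D) (ω : Ω) : 0 ≤ M.lastSvPost μ d ω := singularValue_nonneg _ _

lemma criticalValue_nonneg (d : Fin D) (σ : ℝ≥0) (α : ℝ) (ω : Ω) :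
    0 ≤ M.criticalValue μ d 4 σ α ω := by
  have := phi_nonneg T₀ (M.numDonors d ω) (α / 2)
  have := M.lastSvPre_nonneg (μ := μ) d ω
  unfold criticalValue
  positivity

end PanelModel

/-- The deviation `s = √(log (1 / a))` is chosen so that `exp (-s²) = a`. -/
lemma measure_not_splitNormBound_phi_le {Ω : Type*} [MeasurableSpace Ω] {ν : Measure Ω}
    [IsProbabilityMeasure ν] {T : ℕ} {n : Type*} [Fintype n] {X : Fin T × n → Ω → ℝ}
    (hX : ∀ p, Measurable (X p)) (hind : iIndepFun X ν) (σ : ℝ≥0)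
    (hlaw : ∀ p, ν.map (X p) = gaussianReal 0 (σ ^ 2)) {k : ℕ} (V : Matrix n (Fin k) ℝ) {a : ℝ}
    (ha : a ∈ Set.Ioo (0 : ℝ) 1) :
    ν {ω | ¬ SplitNormBound (Matrix.of fun i j => X (i, j) ω) V
        (2 * σ * phi T (Fintype.card n) a)} ≤ ENNReal.ofReal a := by
  have hlog : 0 < Real.log (1 / a) := Real.log_pos ((one_lt_div ha.1).2 ha.2)
  have h := measure_not_splitNormBound_le hX hind σ hlaw V (Real.sqrt_pos.2 hlog)
  rw [Fintype.card_fin, Real.sq_sqrt hlog.le, one_div, Real.log_inv, neg_neg,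
    Real.exp_log ha.1] at h
  simpa only [phi, one_div, Real.log_inv] using h

end

-- Error probabilities of the test

theorem corollary1 {Ω : Type*} [MeasurableSpace Ω] [StandardBorelSpace Ω]
    (μ : Measure Ω) [IsProbabilityMeasure μ]
    {T₀ T₁ N D r : ℕ} [NeZero D] (M : PanelModel Ω T₀ T₁ N D r)
    (hmeas : M.IsMeasurable) (hsutva : M.SUTVA) (hfactor : M.LatentFactorModel)
    (σ : ℝ≥0) (hgauss : M.GaussianShocks μ σ)
    (d : Fin D) (α : ℝ) (hα : α ∈ Set.Ioo (0 : ℝ) 1)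
    -- right singular vectors of the mean matrices
    (Vpre : ∀ ω, Matrix (M.Donors d ω) (Fin (M.rankPre μ d ω)) ℝ)
    (hVpre : ∀ ω, IsTopRightSingularVectors (M.meanPre μ d ω) (Vpre ω))
    (Vpost : ∀ ω, Matrix (M.Donors d ω) (Fin (M.rankPost μ d ω)) ℝ)
    (hVpost : ∀ ω, IsTopRightSingularVectors (M.meanPost μ d ω) (Vpost ω))
    -- their estimates, from the observed matrices
    (Wpre : ∀ ω, Matrix (M.Donors d ω) (Fin (M.rankPre μ d ω)) ℝ)
    (hWpre : ∀ ω, IsTopRightSingularVectors (M.obsPre d ω) (Wpre ω))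
    (Wpost : ∀ ω, Matrix (M.Donors d ω) (Fin (M.rankPost μ d ω)) ℝ)
    (hWpost : ∀ ω, IsTopRightSingularVectors (M.obsPost d ω) (Wpost ω)) :
    ∀ᵐ ω ∂μ,
      -- Type I error
      (columnSpan (Vpost ω) ≤ columnSpan (Vpre ω) →
        M.condProb μ ω {ω' | M.criticalValue μ d 4 σ α ω' < testStatistic (Wpre ω') (Wpost ω')}
          ≤ ENNReal.ofReal α) ∧
      -- Type II error
      (frobeniusSq (Vpre ω * (Vpre ω)ᵀ * Vpost ω) + 2 * M.criticalValue μ d 4 σ α ω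
          + 4 * σ * M.rankPost μ d ω * phi T₁ (M.numDonors d ω) (α / 2) / M.lastSvPost μ d ω
          < M.rankPost μ d ω →
        ¬ columnSpan (Vpost ω) ≤ columnSpan (Vpre ω) ∧
        M.condProb μ ω {ω' | testStatistic (Wpre ω') (Wpost ω') ≤ M.criticalValue μ d 4 σ α ω'}
          ≤ ENNReal.ofReal α) := by
  filter_upwards [hgauss, M.ae_conditioning_eq (μ := μ) hmeas] with ω ⟨hind, hlaw⟩ hω
  set ν := M.condProb μ ω with hν
  have hobs := M.ae_observed_eq_integral_add_shock hmeas hsutva hfactor hlaw hω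
  have hα2 : α / 2 ∈ Set.Ioo (0 : ℝ) 1 := ⟨by linarith [hα.1], by linarith [hα.2]⟩
  have hpre := measure_not_splitNormBound_phi_le (ν := ν)
    (X := fun (p : Fin T₀ × M.Donors d ω) => M.shock (Fin.castAdd T₁ p.1) p.2.1)
    (fun p => hmeas.shock _ _)
    (hind.precomp (g := fun p : Fin T₀ × M.Donors d ω => (Fin.castAdd T₁ p.1, p.2.1))
      fun p q h => by
        simp only [Prod.mk.injEq, Fin.castAdd_inj] at h
        exact Prod.ext h.1 (Subtype.ext h.2))
    σ (fun p => hlaw _ _) (Vpre ω) hα2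
  have hpost := measure_not_splitNormBound_phi_le (ν := ν)
    (X := fun (p : Fin T₁ × M.Donors d ω) => M.shock (Fin.natAdd T₀ p.1) p.2.1)
    (fun p => hmeas.shock _ _)
    (hind.precomp (g := fun p : Fin T₁ × M.Donors d ω => (Fin.natAdd T₀ p.1, p.2.1))
      fun p q h => by
        simp only [Prod.mk.injEq, Fin.natAdd_inj] at h
        exact Prod.ext h.1 (Subtype.ext h.2))
    σ (fun p => hlaw _ _) (Vpost ω) hα2
  set Bpre := {ω' | ¬ SplitNormBound (Matrix.of fun (i : Fin T₀) (j : M.Donors d ω) =>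
    M.shock (Fin.castAdd T₁ i) j.1 ω') (Vpre ω)
    (2 * σ * phi T₀ (Fintype.card (M.Donors d ω)) (α / 2))} with hBpre
  set Bpost := {ω' | ¬ SplitNormBound (Matrix.of fun (i : Fin T₁) (j : M.Donors d ω) =>
    M.shock (Fin.natAdd T₀ i) j.1 ω') (Vpost ω)
    (2 * σ * phi T₁ (Fintype.card (M.Donors d ω)) (α / 2))} with hBpost
  have hB : ν (Bpre ∪ Bpost) ≤ ENNReal.ofReal α := by
    refine (measure_union_le _ _).trans ((add_le_add hpre hpost).trans (le_of_eq ?_))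
    rw [← ENNReal.ofReal_add hα2.1.le hα2.1.le, add_halves]
  -- The true singular vectors stay at `ω`, while the statistic and the critical value are taken at
  -- `ω'`. Almost surely `ℰ` agrees at both points, which identifies assignments and mean matrices.
  have hgood : ∀ᵐ ω' ∂ν, ω' ∉ Bpre ∪ Bpost →
      (columnSpan (Vpost ω) ≤ columnSpan (Vpre ω) →
        testStatistic (Wpre ω') (Wpost ω') ≤ M.criticalValue μ d 4 σ α ω') ∧
      (frobeniusSq (Vpre ω * (Vpre ω)ᵀ * Vpost ω) + 2 * M.criticalValue μ d 4 σ α ω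
          + 4 * σ * M.rankPost μ d ω * phi T₁ (M.numDonors d ω) (α / 2) / M.lastSvPost μ d ω
          < M.rankPost μ d ω →
        M.criticalValue μ d 4 σ α ω' < testStatistic (Wpre ω') (Wpost ω')) := by
    filter_upwards [hω, hobs] with ω' hcond hobs' hnot
    simp only [Set.mem_union, not_or, hBpre, hBpost, Set.mem_ofPred_eq, not_not] at hnot
    have hassign : (fun n => M.assign n ω') = fun n => M.assign n ω :=
      (congrArg (fun p => p.2.2) hcond).symm
    have hcp : M.condProb μ ω' = M.condProb μ ω := (M.condProb_congr hcond).symm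
    refine testStatistic_bounds (d := d) (assign := fun n => M.assign n ω)
      (assign' := fun n => M.assign n ω')
      (A₀ := fun t n => ∫ x, M.observed (Fin.castAdd T₁ t) n x ∂M.condProb μ ω)
      (A₀' := fun t n => ∫ x, M.observed (Fin.castAdd T₁ t) n x ∂M.condProb μ ω')
      (A₁ := fun t n => ∫ x, M.observed (Fin.natAdd T₀ t) n x ∂M.condProb μ ω)
      (A₁' := fun t n => ∫ x, M.observed (Fin.natAdd T₀ t) n x ∂M.condProb μ ω')
      hassign (by rw [hcp]) (by rw [hcp])
      (Y₀ := fun t n => M.observed (Fin.castAdd T₁ t) n ω')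
      (Y₁ := fun t n => M.observed (Fin.natAdd T₀ t) n ω')
      σ α (hVpre ω) (hVpost ω) (hWpre ω') (hWpost ω') ?_ ?_
    · rw [show groupMatrix (fun n => M.assign n ω) d (fun t n => M.observed (Fin.castAdd T₁ t) n ω') -
          groupMatrix (fun n => M.assign n ω) d
            (fun t n => ∫ x, M.observed (Fin.castAdd T₁ t) n x ∂M.condProb μ ω) =
          Matrix.of fun (i : Fin T₀) (j : M.Donors d ω) => M.shock (Fin.castAdd T₁ i) j.1 ω' by
        ext t j
        simp only [groupMatrix, Matrix.sub_apply, Matrix.of_apply]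
        rw [hobs' (Fin.castAdd T₁ t) j.1]
        ring]
      exact hnot.1
    · rw [show groupMatrix (fun n => M.assign n ω) d (fun t n => M.observed (Fin.natAdd T₀ t) n ω') -
          groupMatrix (fun n => M.assign n ω) d
            (fun t n => ∫ x, M.observed (Fin.natAdd T₀ t) n x ∂M.condProb μ ω) =
          Matrix.of fun (i : Fin T₁) (j : M.Donors d ω) => M.shock (Fin.natAdd T₀ i) j.1 ω' by
        ext t j
        simp only [groupMatrix, Matrix.sub_apply, Matrix.of_apply]
        rw [hobs' (Fin.natAdd T₀ t) j.1]
        ring]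
      exact hnot.2
  refine ⟨fun hspan => (measure_mono_ae ?_).trans hB, fun hlt => ⟨?_, (measure_mono_ae ?_).trans hB⟩⟩
  · filter_upwards [hgood] with ω' h hmem
    by_contra hnot
    exact not_le.2 hmem ((h hnot).1 hspan)
  -- Under nested spans the projection term equals the full rank `r_post`, and the other terms of
  -- the condition are nonnegative, so strict inequality is impossible.
  · intro hspan
    rw [frobeniusSq_mul_transpose_mul_of_columnSpan_le (hVpre ω).1 (hVpost ω).1 hspan,
      Fintype.card_fin] at hlt
    have h1 := M.criticalValue_nonneg (μ := μ) d σ α ω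
    have h2 : 0 ≤ 4 * σ * M.rankPost μ d ω * phi T₁ (M.numDonors d ω) (α / 2) /
        M.lastSvPost μ d ω := by
      have := phi_nonneg T₁ (M.numDonors d ω) (α / 2)
      have := M.lastSvPost_nonneg (μ := μ) d ω
      positivity
    linarith
  · filter_upwards [hgood] with ω' h hmem
    by_contra hnot
    exact not_le.2 ((h hnot).2 hlt) hmem
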